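/- Let $\Omega\subset\mathbb C^2$ be a bounded pseudoconvex domain with $C^\infty$ boundary $M=\partial\Omega$. Let $X_1,X_2$ be smooth real vector fields on $M$ such that $X_1+iX_2$ is a nowhere vanishing vector field of type $(0,1)$ tangent to $M$, and assume that $\Omega$ is of finite type $m$, i.e. $X_1,X_2$ and their commutators up to order $m$ span the tangent space of $M$ at each point. Identifying functions with $(0,1)$-forms, put $\bar\partial_b f=(X_1+iX_2)f$ and $\square_b=\bar\partial_b^*\bar\partial_b$, where $\bar\partial_b^*$ is the adjoint with respect to $L^2(M,w\,d\sigma)$, $\sigma$ is the surface measure and $w>0$ is a smooth density on $M$ (for instance $w=1$); that is, $\square_b f=v$ for $f\in C^2(M)$ and $v\in C(M)$ means $$\int_M v\,\bar\varphi\,w\,d\sigma=\int_M (X_1+iX_2)f\;\overline{(X_1+iX_2)\varphi}\;w\,d\sigma\qquad\text{for all }\varphi\in C^1(M).$$ Let $\rho(x,y)$ be the control metric: the infimum of all $T>0$ for which there is a piecewise $C^1$ path $\gamma:[0,T]\to M$ with $\gamma(0)=x$, $\gamma(T)=y$ and, for almost every $t$, $\gamma'(t)=c_1(t)X_1+c_2(t)X_2$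 with $|c_1(t)|^2+|c_2(t)|^2\le 1$. For a finite sequence $\alpha=(\alpha_1,\dots,\alpha_k)$ of $1$s and $2$s write $D^\alpha=X_{\alpha_1}\cdots X_{\alpha_k}$ and $|\alpha|=k$. Let $d:M\times M\to[0,\infty)$ be any function, smooth off the diagonal, such that - $C^{-1}\rho\le d\le C\rho$ on $M\times M$ for some constant $C>0$; - for all $\alpha,\beta$ there is a constant $C_{\alpha,\beta}$ with $|D_x^\alpha D_y^\beta d(x,y)|\le C_{\alpha,\beta}\,d(x,y)^{1-|\alpha|-|\beta|}$ for all $x\ne y$; - $d(x,y)=d(y,x)$ for all $x,y$; - $|X_{1,y}d(x,y)|+|X_{2,y}d(x,y)|\le 1$ for all $x\ne y$. Let $x_0\in M$ and $0<t_0\le T$, and let $u\in C^2(M\times[0,T])$ be a complex-valued function with $\partial_t^2u+\square_b u=0$ on $M\times[0,T]$. If $u(y,0)=\partial_tu(y,0)=0$ for every $y\in M$ with $d(x_0,y)\le t_0$, then $u(y,t)=0$ for all $t\in[0,t_0]$ and all $y\in M$ with $d(x_0,y)\le t_0-t$. -/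

import Mathlib

open MeasureTheory Set
open scoped ContDiff

noncomputable section

namespace KohnWave

/-- The space `ℂ²` with its Euclidean norm. -/
abbrev C2 : Type := EuclideanSpace ℂ (Fin 2)

/-- `r` is a smooth defining function of the open set `Ω`; it follows that the boundary of `Ω` is
the smooth hypersurface `{r = 0}`. -/
structure IsSmoothDefiningFunction (r : C2 → ℝ) (Ω : Set C2) : Prop where
  smooth : ContDiff ℝ ∞ r
  eq_sublevel : Ω = {z | r z < 0}
  regular : ∀ z, r z = 0 → fderiv ℝ r z ≠ 0

/-- Levi pseudoconvexity of `Ω` at every boundary point: the Levi form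
`∑ ∂²r/∂z_j∂z̄_k w_j w̄_k = (D²r(w, w) + D²r(iw, iw)) / 4` is nonnegative on every complex tangent
vector `w`, i.e. on every `w` such that `w` and `iw` are both tangent to the boundary. -/
def IsLeviPseudoconvex (r : C2 → ℝ) (Ω : Set C2) : Prop :=
  ∀ p ∈ frontier Ω, ∀ w : C2, fderiv ℝ r p w = 0 → fderiv ℝ r p (Complex.I • w) = 0 →
    0 ≤ (fderiv ℝ (fderiv ℝ r) p w w
      + fderiv ℝ (fderiv ℝ r) p (Complex.I • w) (Complex.I • w)) / 4

/-- `Ω` is a bounded pseudoconvex domain in `ℂ²` with smooth boundary, with defining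
function `r`. -/
structure IsPseudoconvexDomain (r : C2 → ℝ) (Ω : Set C2) : Prop where
  connected : IsConnected Ω
  bounded : Bornology.IsBounded Ω
  defining : IsSmoothDefiningFunction r Ω
  pseudoconvex : IsLeviPseudoconvex r Ω

/-- The real vector fields `X 0`, `X 1` on `M = frontier Ω` (the `X₁`, `X₂` of the text) are smooth
and tangent to `M`, and `X 0 + i X 1` is a nowhere vanishing vector field of type `(0,1)`.
A complexified vector `V + iW` has type `(0,1)` exactly if `W = J V`, where `J` is the complex
structure, i.e. multiplication by `i` on `ℂ²`; for example
`∂/∂z̄ = (∂/∂x + i ∂/∂y) / 2` and `J ∂/∂x = ∂/∂y`. -/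
structure IsDbarFrame (r : C2 → ℝ) (Ω : Set C2) (X : Fin 2 → C2 → C2) : Prop where
  smooth : ∀ j, ContDiffOn ℝ ∞ (X j) (frontier Ω)
  tangent : ∀ j, ∀ p ∈ frontier Ω, fderiv ℝ r p (X j p) = 0
  type_zero_one : ∀ p ∈ frontier Ω, X 1 p = Complex.I • X 0 p
  ne_zero : ∀ p ∈ frontier Ω, X 0 p ≠ 0

/-- The derivative `Y f` on the hypersurface `M` of a function `f` on `M` along a vector field `Y`
tangent to `M`. Only the values of `f` on `M` matter, and if `f` is differentiable within `M` then
the value on a tangent vector does not depend on the choice made by `fderivWithin`. -/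
def along {F : Type*} [NormedAddCommGroup F] [NormedSpace ℝ F]
    (M : Set C2) (Y : C2 → C2) (f : C2 → F) (p : C2) : F :=
  fderivWithin ℝ f M p (Y p)

/-- The ordered derivative `D^α = X_{α₁} X_{α₂} ⋯ X_{α_k}` (the last one acts first). -/
def orderedDeriv {F : Type*} [NormedAddCommGroup F] [NormedSpace ℝ F]
    (M : Set C2) (X : Fin 2 → C2 → C2) (α : List (Fin 2)) (f : C2 → F) : C2 → F :=
  α.foldr (fun j g => along M (X j) g) f

/-- `IteratedCommutator M X k Y`: `Y` is a commutator `[X_{j₁}, [X_{j₂}, … , X_{j_k}]]` of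
length `k` of the fields `X 0`, `X 1` on `M` (length one: the fields themselves). -/
inductive IteratedCommutator (M : Set C2) (X : Fin 2 → C2 → C2) : ℕ → (C2 → C2) → Prop
  | base (j : Fin 2) : IteratedCommutator M X 1 (X j)
  | bracket (j : Fin 2) (k : ℕ) (Y : C2 → C2) (h : IteratedCommutator M X k Y) :
      IteratedCommutator M X (k + 1) (VectorField.lieBracketWithin ℝ (X j) Y M)

/-- Finite type `m`: the fields and their commutators up to order `m` span the tangent space
of `M = frontier Ω` (the kernel of `dr`) at each point. -/
def IsOfFiniteType (r : C2 → ℝ) (Ω : Set C2) (X : Fin 2 → C2 → C2) (m : ℕ) : Prop :=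
  ∀ p ∈ frontier Ω,
    Submodule.span ℝ {v : C2 | ∃ k ≤ m, ∃ Y, IteratedCommutator (frontier Ω) X k Y ∧ Y p = v}
      = LinearMap.ker (fderiv ℝ r p : C2 →ₗ[ℝ] ℝ)

/-- `γ` is piecewise `C¹` on `[0, T]`: it is `C¹` on each closed interval of a finite partition. -/
def PiecewiseC1 (γ : ℝ → C2) (T : ℝ) : Prop :=
  ∃ (n : ℕ) (τ : ℕ → ℝ), Monotone τ ∧ τ 0 = 0 ∧ τ n = T ∧
    ∀ i < n, ContDiffOn ℝ 1 γ (Icc (τ i) (τ (i + 1)))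

/-- `γ` is an admissible path in `M` from `x` to `y` on the time interval `[0, T]`: piecewise
`C¹` with `γ' = c₁ X₁ + c₂ X₂` and `|c₁|² + |c₂|² ≤ 1` almost everywhere. -/
def IsAdmissiblePath (M : Set C2) (X : Fin 2 → C2 → C2) (x y : C2) (T : ℝ) (γ : ℝ → C2) : Prop :=
  PiecewiseC1 γ T ∧ (∀ t ∈ Icc 0 T, γ t ∈ M) ∧ γ 0 = x ∧ γ T = y ∧
    ∃ c : Fin 2 → ℝ → ℝ, ∀ᵐ t ∂(volume.restrict (Icc (0 : ℝ) T)),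
      HasDerivAt γ (c 0 t • X 0 (γ t) + c 1 t • X 1 (γ t)) t ∧ |c 0 t| ^ 2 + |c 1 t| ^ 2 ≤ 1

/-- The control (Carnot–Carathéodory) metric, with value `⊤` if no admissible path exists. -/
def controlDist (M : Set C2) (X : Fin 2 → C2 → C2) (x y : C2) : ENNReal :=
  ⨅ (T : ℝ) (_ : 0 < T) (_ : ∃ γ, IsAdmissiblePath M X x y T γ), ENNReal.ofReal T

/-- `d` is a normalized smooth symmetric substitute for the control metric on `M`. -/
structure IsSmoothControlMetric (M : Set C2) (X : Fin 2 → C2 → C2) (d : C2 → C2 → ℝ) : Prop where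
  nonneg : ∀ x ∈ M, ∀ y ∈ M, 0 ≤ d x y
  comparable : ∃ C : NNReal, ∀ x ∈ M, ∀ y ∈ M,
    ENNReal.ofReal (d x y) ≤ C * controlDist M X x y ∧
      controlDist M X x y ≤ C * ENNReal.ofReal (d x y)
  smooth : ContDiffOn ℝ ∞ (fun q : C2 × C2 => d q.1 q.2) {q | q.1 ∈ M ∧ q.2 ∈ M ∧ q.1 ≠ q.2}
  bounds : ∀ α β : List (Fin 2), ∃ C : ℝ, ∀ x ∈ M, ∀ y ∈ M, x ≠ y →
    |orderedDeriv M X α (fun x' => orderedDeriv M X β (fun y' => d x' y') y) x|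
      ≤ C * d x y ^ (1 - (α.length : ℤ) - (β.length : ℤ))
  symm : ∀ x ∈ M, ∀ y ∈ M, d x y = d y x
  normalized : ∀ x ∈ M, ∀ y ∈ M, x ≠ y →
    |along M (X 0) (fun y' => d x y') y| + |along M (X 1) (fun y' => d x y') y| ≤ 1

/-- The operator `∂̄_b f = (X₁ + i X₂) f`, forms of type `(0,1)` being identified with functions. -/
def dbarb (M : Set C2) (X : Fin 2 → C2 → C2) (f : C2 → ℂ) (p : C2) : ℂ :=
  along M (X 0) f p + Complex.I * along M (X 1) f p

/-- The `L²` pairing `∫_M f ḡ w dσ` on `M`, where `σ` is the surface measure (three-dimensional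
Hausdorff measure; its normalization is immaterial) and `w` is a density. -/
def pairing (M : Set C2) (w : C2 → ℝ) (f g : C2 → ℂ) : ℂ :=
  ∫ p in M, f p * starRingEnd ℂ (g p) * (w p : ℂ) ∂μH[3]

/-- `∂̄_b* g = v`: the continuous function `v` is the image of `g` under the adjoint of `∂̄_b` for the
`L²` pairing, i.e. `⟨v, φ⟩ = ⟨g, ∂̄_b φ⟩` for all `φ` of class `C¹` on `M`. -/
def IsDbarbAdjoint (M : Set C2) (X : Fin 2 → C2 → C2) (w : C2 → ℝ) (g v : C2 → ℂ) : Prop :=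
  ContinuousOn v M ∧
    ∀ φ : C2 → ℂ, ContDiffOn ℝ 1 φ M → pairing M w v φ = pairing M w g (dbarb M X φ)

/-- `□_b f = v`, where `□_b = ∂̄_b* ∂̄_b` is the Kohn Laplacian on functions. -/
def IsKohnLaplacian (M : Set C2) (X : Fin 2 → C2 → C2) (w : C2 → ℝ) (f v : C2 → ℂ) : Prop :=
  IsDbarbAdjoint M X w (dbarb M X f) v

/-- The first time derivative on `[0, T]` (one-sided at the end points). -/
def timeDeriv (T : ℝ) (u : C2 → ℝ → ℂ) (y : C2) (t : ℝ) : ℂ :=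
  derivWithin (u y) (Icc 0 T) t

/-- `u` is a classical solution of `∂_t² u + □_b u = 0` on `M × [0, T]`: it is of class `C²` there
and `□_b (u(·, t)) = -∂_t² u(·, t)` for every `t` in `[0, T]`. -/
def IsWaveSolution (M : Set C2) (X : Fin 2 → C2 → C2) (w : C2 → ℝ) (T : ℝ)
    (u : C2 → ℝ → ℂ) : Prop :=
  ContDiffOn ℝ 2 (fun q : C2 × ℝ => u q.1 q.2) (M ×ˢ Icc 0 T) ∧
    ∀ t ∈ Icc 0 T, IsKohnLaplacian M X w (fun y => u y t)
      (fun y => -timeDeriv T (timeDeriv T u) y t)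

end KohnWave

end

/-! The proof is the energy method. For a nonnegative weight `θ`, consider `E(t) = ∫_M θ (|∂_t u|² +
|∂̄_b u|²) w`. Testing the weak equation with `θ ∂_t u` cancels every term in which `θ` is not
differentiated (`IsWaveSolution.hasDerivAt_energy`). What remains is `∂_t θ` times the energy
density and a flux containing `(X₁ + iX₂)θ`. For `θ = η(t₀ - t - d(x₀, y))` with `η` nondecreasing
and zero on `(-∞, 0]`, the normalization of `d` bounds `|(X₁ + iX₂)θ|` by `-∂_t θ`. By `2|a||b| ≤
|a|² + |b|²` the flux is then absorbed (`energy_flux_le`), and `E` cannot grow from its initial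
value `0`.

The obstacle is that `d(x₀, ·)` need not be differentiable at `x₀`. The weight is therefore
multiplied by a cutoff that vanishes near `x₀` and equals `1` outside a ball of radius `2ε`. Its
gradient is `O(1/ε)` and the ball has surface measure `O(ε³)`, so the cutoff costs only `O(ε²)`
(`IsWaveSolution.exists_cutoff_energy_le`). As `ε → 0`, positivity of surface measure on relatively
open sets forces `∂_t u = 0` in the open cone off the line over `x₀`, and `u = 0` follows by
integrating in time. Continuity gives the line over `x₀` and the boundary of the cone.

Since `M` is a thin subset of `ℂ²`, derivatives within `M` are not unique as linear maps. They are
controlled through curves in `M` (`IsVelocity`) and local parametrizations, which also carry the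
measure estimates. -/

namespace KohnWave

open Filter Topology Metric

/-! ### Local geometry and surface measure of a smooth hypersurface -/

/-- The model space of a hypersurface in `ℂ²`. -/
abbrev E3 : Type := EuclideanSpace ℝ (Fin 3)

lemma finrank_C2 : Module.finrank ℝ C2 = 4 := by
  rw [finrank_real_of_complex]; simp

lemma finrank_ker {L : C2 →L[ℝ] ℝ} (hL : L ≠ 0) :
    Module.finrank ℝ (LinearMap.ker (L : C2 →ₗ[ℝ] ℝ)) = 3 := by
  have h := LinearMap.finrank_range_add_finrank_ker (L : C2 →ₗ[ℝ] ℝ)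
  have hs : LinearMap.range (L : C2 →ₗ[ℝ] ℝ) = ⊤ := by
    rw [LinearMap.range_eq_top]
    apply LinearMap.surjective
    intro h; apply hL; ext x; exact congrArg (fun f : C2 →ₗ[ℝ] ℝ => f x) h
  rw [hs, finrank_top, Module.finrank_self, finrank_C2] at h
  omega

/-- A smooth hypersurface `{r = 0}` is locally parametrized by a smooth map which has a left inverse
that is affine on the ambient space. -/
lemma exists_local_parametrization {r : C2 → ℝ} (hr : ContDiff ℝ ∞ r) {p : C2}
    (hp : r p = 0) (hdp : fderiv ℝ r p ≠ 0) :
    ∃ (Φ : E3 → C2) (P : C2 →L[ℝ] E3), Φ 0 = p ∧ ContDiffAt ℝ ∞ Φ 0 ∧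
      (∀ᶠ v in 𝓝 0, r (Φ v) = 0 ∧ P (Φ v - p) = v) ∧
      ∀ᶠ z in 𝓝 p, r z = 0 → Φ (P (z - p)) = z := by
  set L := fderiv ℝ r p with hLdef
  obtain ⟨n, hn⟩ : ∃ n, L n = 1 := by
    obtain ⟨x, hx⟩ := DFunLike.ne_iff.mp hdp
    refine ⟨(L x)⁻¹ • x, ?_⟩
    rw [map_smul, smul_eq_mul, inv_mul_cancel₀ hx]
  let K := LinearMap.ker (L : C2 →ₗ[ℝ] ℝ)
  let eK : K ≃L[ℝ] E3 := ContinuousLinearEquiv.ofFinrankEq (by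
    rw [finrank_ker hdp]; simp)
  let Q : C2 →L[ℝ] K := (ContinuousLinearMap.id ℝ C2 - L.smulRight n).codRestrict K (by
    intro x; simp [K, hn])
  have hQ : ∀ x, (Q x : C2) = x - L x • n := fun x => rfl
  have hQK : ∀ k : K, Q k = k := by
    intro k
    apply Subtype.ext
    rw [hQ, show L k = 0 from k.2]; simp
  -- `G` straightens the hypersurface: `L (G z - p) = r z`, so it carries `{r = 0}` into the affine
  -- tangent plane at `p`. Its differential at `p` is the identity, so the inverse function theorem
  -- applies.
  let G : C2 → C2 := fun z => z + (r z - L (z - p)) • n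
  have hG : ContDiff ℝ ∞ G := by
    unfold G
    have : ContDiff ℝ ∞ fun z => L (z - p) := L.contDiff.comp (contDiff_id.sub contDiff_const)
    exact contDiff_id.add ((hr.sub this).smul contDiff_const)
  have hGp : G p = p := by simp [G, hp]
  have hGd : HasFDerivAt G ((ContinuousLinearEquiv.refl ℝ C2 : C2 ≃L[ℝ] C2) : C2 →L[ℝ] C2) p := by
    have h1 : HasFDerivAt r L p := (hr.differentiable (by simp) p).hasFDerivAt
    have h2 : HasFDerivAt (fun z => L (z - p)) L p :=
      L.hasFDerivAt.comp p ((hasFDerivAt_id p).sub_const p)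
    have h3 := (hasFDerivAt_id (𝕜 := ℝ) p).add ((h1.sub h2).smul_const n)
    refine h3.congr_fderiv ?_
    ext x; simp
  have hn0 : (∞ : WithTop ℕ∞) ≠ 0 := by simp
  let e := hG.contDiffAt.toOpenPartialHomeomorph G hGd hn0
  have he : ∀ z, e z = G z := fun z => rfl
  have hps : p ∈ e.source := hG.contDiffAt.mem_toOpenPartialHomeomorph_source hGd hn0
  have hpt : p ∈ e.target := by
    have := e.map_source hps
    rwa [he, hGp] at this
  have hsp : e.symm p = p := by
    conv_lhs => rw [← hGp, ← he]
    exact e.left_inv hps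
  have hsd : ContDiffAt ℝ ∞ e.symm p :=
    e.contDiffAt_symm hpt (by rw [hsp]; exact hGd) hG.contDiffAt
  have hLG : ∀ z, L (G z - p) = r z := by
    intro z
    have : G z - p = (z - p) + (r z - L (z - p)) • n := by simp only [G]; abel
    rw [this, map_add, map_smul, hn]; simp
  have hcont : Continuous fun v : E3 => p + ((eK.symm v : K) : C2) := by fun_prop
  -- `G` moves points only along `n`, which the projection `Q` kills; this is why the left inverse
  -- of the parametrization is affine.
  have hQG : ∀ z, Q (z - p) = Q (G z - p) := by
    intro z
    apply Subtype.ext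
    rw [hQ, hQ, hLG]; simp only [G, sub_smul]; abel
  refine ⟨fun v => e.symm (p + (eK.symm v : K)), (eK : K →L[ℝ] E3).comp Q, by simp [hsp], ?_, ?_, ?_⟩
  · have h1 : ContDiffAt ℝ ∞ (fun v : E3 => p + ((eK.symm v : K) : C2)) 0 :=
      contDiffAt_const.add
        ((K.subtypeL.comp (eK.symm : E3 →L[ℝ] K)).contDiff.contDiffAt)
    refine ContDiffAt.comp (0 : E3) (g := e.symm) ?_ h1
    simpa using hsd
  · have : ∀ᶠ v : E3 in 𝓝 0, p + ((eK.symm v : K) : C2) ∈ e.target := by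
      apply hcont.continuousAt.eventually_mem
      apply e.open_target.mem_nhds
      simpa using hpt
    filter_upwards [this] with v hv
    have hGv : G (e.symm (p + (eK.symm v : K))) = p + (eK.symm v : K) := e.right_inv hv
    constructor
    · rw [← hLG, hGv]; simp only [add_sub_cancel_left]; exact (eK.symm v).2
    · simp only [ContinuousLinearMap.comp_apply]
      rw [hQG, hGv]
      simp [hQK]
  · filter_upwards [e.open_source.mem_nhds hps] with z hz hrz
    have : ((Q (z - p) : K) : C2) = G z - p := by
      rw [hQG, hQ, hLG, hrz]; simp
    simp only [ContinuousLinearMap.comp_apply, ContinuousLinearEquiv.coe_coe,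
      ContinuousLinearEquiv.symm_apply_apply, this]
    rw [add_sub_cancel]
    exact e.left_inv hz

/-- The differential of a parametrization of `{r = 0}` with affine left inverse `P (· - p)` inverts
`P` on tangent vectors. -/
lemma fderiv_parametrization_apply {r : C2 → ℝ} {Φ : E3 → C2} {P : C2 →L[ℝ] E3} {p : C2} {v : E3}
    (hΦ : DifferentiableAt ℝ Φ v) (hev : ∀ᶠ v' in 𝓝 v, r (Φ v') = 0 ∧ P (Φ v' - p) = v')
    (hr : DifferentiableAt ℝ r (Φ v)) (h0 : fderiv ℝ r (Φ v) ≠ 0) {ξ : C2}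
    (hξ : fderiv ℝ r (Φ v) ξ = 0) : fderiv ℝ Φ v (P ξ) = ξ := by
  set D := fderiv ℝ Φ v
  have hrD : (fderiv ℝ r (Φ v)).comp D = 0 := by
    have h1 : HasFDerivAt (fun v' => r (Φ v')) ((fderiv ℝ r (Φ v)).comp D) v :=
      hr.hasFDerivAt.comp v hΦ.hasFDerivAt
    have h2 : HasFDerivAt (fun v' => r (Φ v')) (0 : E3 →L[ℝ] ℝ) v :=
      (hasFDerivAt_const (0 : ℝ) v).congr_of_eventuallyEq (hev.mono fun _ h => h.1)
    exact h1.unique h2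
  have hPD : P.comp D = ContinuousLinearMap.id ℝ E3 := by
    have h1 : HasFDerivAt (fun v' => P (Φ v' - p)) (P.comp D) v :=
      P.hasFDerivAt.comp v (hΦ.hasFDerivAt.sub_const p)
    have h2 : HasFDerivAt (fun v' => P (Φ v' - p)) (ContinuousLinearMap.id ℝ E3) v :=
      (hasFDerivAt_id v).congr_of_eventuallyEq (hev.mono fun _ h => h.2)
    exact h1.unique h2
  have hPD' : ∀ x, P (D x) = x := fun x => congrArg (fun f : E3 →L[ℝ] E3 => f x) hPD
  have hle : LinearMap.range (D : E3 →ₗ[ℝ] C2) ≤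
      LinearMap.ker (fderiv ℝ r (Φ v) : C2 →ₗ[ℝ] ℝ) := by
    rintro _ ⟨x, rfl⟩
    exact congrArg (fun f : E3 →L[ℝ] ℝ => f x) hrD
  have hinj : Function.Injective (D : E3 →ₗ[ℝ] C2) := fun x y h => by
    rw [← hPD' x, ← hPD' y]; exact congrArg P h
  -- `D` is injective because `P` inverts it, so its range has dimension 3 and fills the tangent
  -- space.
  have heq := Submodule.eq_of_le_of_finrank_eq hle (by
    rw [finrank_ker h0, LinearMap.finrank_range_of_inj hinj]; simp)
  have : ξ ∈ LinearMap.range (D : E3 →ₗ[ℝ] C2) := by rw [heq]; exact hξ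
  obtain ⟨x, rfl⟩ := this
  exact congrArg D (hPD' x)

/-- A zero of `r` outside the closure of `Ω` would be a local minimum of `r`, contradicting `dr ≠ 0`
there. -/
lemma IsSmoothDefiningFunction.frontier_eq {r : C2 → ℝ} {Ω : Set C2}
    (h : IsSmoothDefiningFunction r Ω) : frontier Ω = {z | r z = 0} := by
  have hc : Continuous r := h.smooth.continuous
  have ho : IsOpen Ω := by rw [h.eq_sublevel]; exact isOpen_lt hc continuous_const
  apply Subset.antisymm
  · rw [h.eq_sublevel]; exact frontier_lt_subset_eq hc continuous_const
  · intro z hz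
    rw [ho.frontier_eq]
    refine ⟨?_, ?_⟩
    · by_contra hcl
      rw [mem_closure_iff_frequently, not_frequently] at hcl
      have hmin : IsLocalMin r z := by
        filter_upwards [hcl] with y hy
        rw [h.eq_sublevel] at hy
        rw [show r z = 0 from hz]; exact not_lt.mp hy
      exact h.regular z hz hmin.fderiv_eq_zero
    · rw [h.eq_sublevel]; exact fun hlt => (lt_irrefl (0 : ℝ)) (by
        have h1 : r z < 0 := hlt
        rwa [show r z = 0 from hz] at h1)

lemma isCompact_frontier {Ω : Set C2} (h : Bornology.IsBounded Ω) : IsCompact (frontier Ω) :=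
  isCompact_of_isClosed_isBounded isClosed_frontier (h.closure.subset frontier_subset_closure)

/-- Every tangent vector of `{r = 0}` is the velocity of a smooth curve in `{r = 0}`. -/
lemma exists_curve_of_tangent {r : C2 → ℝ} (hr : ContDiff ℝ ∞ r) {p : C2}
    (hp : r p = 0) (hdp : fderiv ℝ r p ≠ 0) {ξ : C2} (hξ : fderiv ℝ r p ξ = 0) :
    ∃ γ : ℝ → C2, ContDiffAt ℝ ∞ γ 0 ∧ γ 0 = p ∧ HasDerivAt γ ξ 0 ∧ ∀ᶠ s in 𝓝 0, r (γ s) = 0 := by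
  obtain ⟨Φ, P, h0, hΦ, hev, -⟩ := exists_local_parametrization hr hp hdp
  have hl : ContDiff ℝ ∞ fun s : ℝ => s • P ξ := contDiff_id.smul contDiff_const
  have hl0 : (0 : ℝ) • P ξ = 0 := zero_smul _ _
  have hd : DifferentiableAt ℝ Φ 0 := hΦ.differentiableAt (by simp)
  refine ⟨fun s => Φ (s • P ξ), ?_, by simp [h0], ?_, ?_⟩
  · exact ContDiffAt.comp (0 : ℝ) (g := Φ) (by rwa [hl0]) hl.contDiffAt
  · have h1 : HasFDerivAt Φ (fderiv ℝ Φ 0) ((0 : ℝ) • P ξ) := by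
      rw [hl0]; exact hd.hasFDerivAt
    have h2 : HasDerivAt (fun s : ℝ => s • P ξ) (P ξ) 0 := by
      simpa using (hasDerivAt_id (0 : ℝ)).smul_const (P ξ)
    have := h1.comp_hasDerivAt (0 : ℝ) h2
    rwa [fderiv_parametrization_apply hd hev (hr.differentiable (by simp) _)
      (by rwa [h0]) (by rwa [h0])] at this
  · have hc : Tendsto (fun s : ℝ => s • P ξ) (𝓝 0) (𝓝 0) := by
      have := hl.continuous.tendsto 0; rwa [hl0] at this
    exact (hc.eventually hev).mono fun _ h => h.1

lemma finrank_E3 : Module.finrank ℝ E3 = 3 := by simp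

lemma isAddHaarMeasure_hausdorff_E3 : Measure.IsAddHaarMeasure (μH[3] : Measure E3) := by
  have h := isAddHaarMeasure_hausdorffMeasure (E := E3)
  rw [finrank_E3] at h
  exact_mod_cast h

/-- The surface measure of a small ball of radius `ε` in a hypersurface is `O(ε³)`. -/
lemma exists_hausdorffMeasure_closedBall_le {r : C2 → ℝ} (hr : ContDiff ℝ ∞ r) {p : C2}
    (hp : r p = 0) (hdp : fderiv ℝ r p ≠ 0) :
    ∃ C : ℝ, 0 ≤ C ∧ ∃ δ > 0, ∀ ε, 0 < ε → ε ≤ δ →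
      μH[3] ({z | r z = 0} ∩ closedBall p ε) ≤ ENNReal.ofReal (C * ε ^ 3) := by
  obtain ⟨Φ, P, h0, hΦ, hev, hev'⟩ := exists_local_parametrization hr hp hdp
  have := isAddHaarMeasure_hausdorff_E3
  obtain ⟨K, t, ht, hK⟩ := (hΦ.of_le (show (1 : WithTop ℕ∞) ≤ ∞ by simp)).exists_lipschitzOnWith
  obtain ⟨δ₁, hδ₁, hb₁⟩ := Metric.mem_nhds_iff.mp ht
  obtain ⟨δ₂, hδ₂, hb₂⟩ := Metric.eventually_nhds_iff_ball.mp hev'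
  -- The added `1` keeps `A` positive, so that it can be divided by even if `‖P‖ = 0`.
  set A : ℝ := ‖P‖ + 1
  have hA : 0 < A := by positivity
  set m : ENNReal := μH[3] (ball (0 : E3) 1)
  have hm : m ≠ ⊤ := measure_ball_lt_top.ne
  refine ⟨(K : ℝ) ^ 3 * ((A ^ 3) * m.toReal), by positivity,
    min (δ₁ / (2 * A)) (δ₂ / 2), by positivity, ?_⟩
  intro ε hε hεδ
  have h1 : ε * A < δ₁ := by
    have := hεδ.trans (min_le_left _ _)
    rw [le_div_iff₀ (by positivity)] at this
    nlinarith [mul_pos hε hA]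
  have h2 : ε < δ₂ := by
    have := hεδ.trans (min_le_right _ _)
    linarith
  have hsub : {z | r z = 0} ∩ closedBall p ε ⊆ Φ '' (closedBall 0 (A * ε)) := by
    rintro z ⟨hz, hzb⟩
    rw [mem_closedBall, dist_eq_norm] at hzb
    refine ⟨P (z - p), ?_, hb₂ z (by rw [mem_ball, dist_eq_norm]; linarith) hz⟩
    rw [mem_closedBall_zero_iff]
    calc ‖P (z - p)‖ ≤ ‖P‖ * ‖z - p‖ := P.le_opNorm _
      _ ≤ A * ε := by
        apply mul_le_mul _ hzb (norm_nonneg _) hA.le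
        simp [A]
  have hL : LipschitzOnWith K Φ (closedBall 0 (A * ε)) :=
    hK.mono ((closedBall_subset_ball (by linarith [mul_comm A ε])).trans hb₁)
  have hball : μH[3] (closedBall (0 : E3) (A * ε)) = ENNReal.ofReal ((A * ε) ^ 3) * m := by
    have := Measure.addHaar_closedBall (μH[3] : Measure E3) (0 : E3) (r := A * ε) (by positivity)
    rwa [finrank_E3] at this
  calc μH[3] ({z | r z = 0} ∩ closedBall p ε) ≤ μH[3] (Φ '' (closedBall 0 (A * ε))) :=
        measure_mono hsub
    _ ≤ (K : ENNReal) ^ (3 : ℝ) * μH[3] (closedBall (0 : E3) (A * ε)) :=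
        hL.hausdorffMeasure_image_le (by norm_num)
    _ = ENNReal.ofReal ((K : ℝ) ^ 3 * (A ^ 3 * m.toReal) * ε ^ 3) := by
        rw [hball, show (3 : ℝ) = ((3 : ℕ) : ℝ) by norm_num, ENNReal.rpow_natCast,
          ← ENNReal.ofReal_coe_nnreal, ← ENNReal.ofReal_pow (by positivity)]
        nth_rewrite 1 [← ENNReal.ofReal_toReal hm]
        rw [← ENNReal.ofReal_mul (by positivity), ← ENNReal.ofReal_mul (by positivity)]
        congr 1; ring

/-- The surface measure of a compact hypersurface is finite. -/
lemma hausdorffMeasure_hypersurface_lt_top {r : C2 → ℝ} (hr : ContDiff ℝ ∞ r)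
    (hreg : ∀ z, r z = 0 → fderiv ℝ r z ≠ 0) (hc : IsCompact {z | r z = 0}) :
    μH[3] {z | r z = 0} < ⊤ := by
  refine hc.measure_lt_top_of_nhdsWithin fun p hp => ?_
  obtain ⟨C, -, δ, hδ, h⟩ := exists_hausdorffMeasure_closedBall_le hr hp (hreg p hp)
  exact ⟨_, inter_mem self_mem_nhdsWithin (mem_nhdsWithin_of_mem_nhds (closedBall_mem_nhds p hδ)),
    (h δ hδ le_rfl).trans_lt ENNReal.ofReal_lt_top⟩

/-- The surface measure is positive on nonempty relatively open subsets of a hypersurface. -/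
lemma hausdorffMeasure_hypersurface_pos {r : C2 → ℝ} (hr : ContDiff ℝ ∞ r) {p : C2}
    (hp : r p = 0) (hdp : fderiv ℝ r p ≠ 0) {V : Set C2} (hV : V ∈ 𝓝[{z | r z = 0}] p) :
    0 < μH[3] ({z | r z = 0} ∩ V) := by
  obtain ⟨Φ, P, h0, hΦ, hev, -⟩ := exists_local_parametrization hr hp hdp
  have := isAddHaarMeasure_hausdorff_E3
  -- A Lipschitz map sends null sets of `μH[3]` to null sets, while the image under `P (· - p)` is a
  -- neighborhood of `0` in `E3`.
  have hP : LipschitzWith ‖P‖₊ fun z => P (z - p) := by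
    apply LipschitzWith.of_dist_le_mul
    intro x y
    rw [dist_eq_norm, dist_eq_norm, ← map_sub, sub_sub_sub_cancel_right]
    exact P.le_opNorm _
  have hmem : (fun z => P (z - p)) '' ({z | r z = 0} ∩ V) ∈ 𝓝 (0 : E3) := by
    have ht : Tendsto Φ (𝓝 0) (𝓝[{z | r z = 0}] p) := by
      apply tendsto_nhdsWithin_iff.mpr
      refine ⟨?_, hev.mono fun _ h => h.1⟩
      have := hΦ.continuousAt.tendsto; rwa [h0] at this
    filter_upwards [hev, ht hV] with v hv hvV
    exact ⟨Φ v, ⟨hv.1, hvV⟩, hv.2⟩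
  have h1 := Measure.measure_pos_of_mem_nhds (μH[3] : Measure E3) hmem
  have h2 := hP.hausdorffMeasure_image_le (d := 3) (by norm_num) ({z | r z = 0} ∩ V)
  refine pos_iff_ne_zero.mpr fun h => ?_
  rw [h, mul_zero] at h2
  exact absurd (h1.trans_le h2) (lt_irrefl _)

/-- From every point of the hypersurface starts an admissible path along `X 0`; it reaches, in
arbitrarily short time, points arbitrarily close to and different from the starting point. -/
lemma exists_admissiblePath {r : C2 → ℝ} (hr : ContDiff ℝ ∞ r)
    (hreg : ∀ z, r z = 0 → fderiv ℝ r z ≠ 0) {X : Fin 2 → C2 → C2}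
    (hX : ContDiffOn ℝ ∞ (X 0) {z | r z = 0})
    (htan : ∀ z, r z = 0 → fderiv ℝ r z (X 0 z) = 0) {p : C2} (hp : r p = 0) (hne : X 0 p ≠ 0) :
    ∃ γ : ℝ → C2, Tendsto γ (𝓝[>] 0) (𝓝[≠] p) ∧
      ∀ᶠ τ in 𝓝[>] 0, IsAdmissiblePath {z | r z = 0} X p (γ τ) τ γ := by
  obtain ⟨Φ, P, h0, hΦ, hev, -⟩ := exists_local_parametrization hr hp (hreg p hp)
  have hXΦ : ContDiffAt ℝ ∞ (fun v => X 0 (Φ v)) 0 := by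
    have h1 : ContDiffWithinAt ℝ ∞ (X 0) {z | r z = 0} (Φ 0) := by
      rw [h0]; exact hX p hp
    refine (h1.comp_of_preimage_mem_nhdsWithin (0 : E3) (s := univ) hΦ ?_).contDiffAt univ_mem
    rw [nhdsWithin_univ]; exact hev.mono fun _ h => h.1
  -- The field `P (X 0 ∘ Φ)` on the model space is the pullback of `X 0`. Picard–Lindelöf is applied
  -- there, and `Φ` carries the solution to an integral curve that stays in the hypersurface.
  have hξ : ContDiffAt ℝ 1 (fun v => P (X 0 (Φ v))) 0 :=
    (P.contDiff.contDiffAt.comp (0 : E3) hXΦ).of_le (by simp)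
  obtain ⟨α, hα0, ε, hε, hα⟩ :=
    hξ.exists_forall_mem_closedBall_exists_eq_forall_mem_Ioo_hasDerivAt₀ 0
  have hαc : ContinuousAt α 0 := (hα 0 (by simp [hε])).continuousAt
  have hαt : Tendsto α (𝓝 0) (𝓝 0) := by
    have := hαc.tendsto; rwa [hα0] at this
  have hΦd : ∀ᶠ v in 𝓝 (0 : E3), DifferentiableAt ℝ Φ v := by
    have := (hΦ.of_le (show (1 : WithTop ℕ∞) ≤ ∞ by simp)).eventually (by simp)
    exact this.mono fun v h => h.differentiableAt (by simp)
  have hXc : ∀ᶠ v in 𝓝 (0 : E3), ContinuousAt (fun v => X 0 (Φ v)) v := by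
    have := (hXΦ.of_le (show (1 : WithTop ℕ∞) ≤ ∞ by simp)).eventually (by simp)
    exact this.mono fun v h => h.continuousAt
  have hall : ∀ᶠ t in 𝓝 (0 : ℝ), r (Φ (α t)) = 0 ∧ HasDerivAt (fun t => Φ (α t)) (X 0 (Φ (α t))) t
      ∧ ContinuousAt (fun t => X 0 (Φ (α t))) t := by
    have hI : ∀ᶠ t in 𝓝 (0 : ℝ), t ∈ Ioo (0 - ε) (0 + ε) :=
      Ioo_mem_nhds (by linarith) (by linarith)
    filter_upwards [hI, hαt.eventually hev.eventually_nhds, hαt.eventually hΦd,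
      hαt.eventually hXc] with t ht hevt hd hc
    have hself := hevt.self_of_nhds
    refine ⟨hself.1, ?_, hc.comp (hα t ht).continuousAt⟩
    have := hd.hasFDerivAt.comp_hasDerivAt t (hα t ht)
    rwa [fderiv_parametrization_apply hd hevt (hr.differentiable (by simp) _)
      (hreg _ hself.1) (htan _ hself.1)] at this
  obtain ⟨δ, hδ, hball⟩ := Metric.eventually_nhds_iff_ball.mp hall
  have hγ0 : Φ (α 0) = p := by rw [hα0, h0]
  refine ⟨fun t => Φ (α t), ?_, ?_⟩
  · have hd0 := (hall.self_of_nhds).2.1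
    apply tendsto_nhdsWithin_iff.mpr
    constructor
    · have := hd0.continuousAt.tendsto
      rw [hγ0] at this
      exact this.mono_left nhdsWithin_le_nhds
    · have := hd0.eventually_ne (c := p) (by rw [hγ0]; exact hne)
      exact this.filter_mono (nhdsWithin_mono _ fun x hx => ne_of_gt hx)
  · have : ∀ᶠ τ in 𝓝[>] (0 : ℝ), τ ∈ Ioo 0 δ := Ioo_mem_nhdsGT hδ
    filter_upwards [this] with τ hτ
    have hmem : ∀ t ∈ Icc 0 τ, t ∈ ball (0 : ℝ) δ := fun t ht => by
      rw [mem_ball_zero_iff, Real.norm_eq_abs, abs_of_nonneg ht.1]; exact ht.2.trans_lt hτ.2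
    -- The partition has the single interval `[0, τ]`, and the controls are `c = (1, 0)`.
    refine ⟨⟨1, fun i => if i = 0 then 0 else τ, ?_, by simp, by simp, ?_⟩,
      fun t ht => (hball t (hmem t ht)).1, hγ0, rfl, fun j _ => if j = 0 then 1 else 0, ?_⟩
    · intro i j hij
      by_cases hi : i = 0
      · by_cases hj : j = 0 <;> simp [hi, hj, hτ.1.le]
      · have hj : j ≠ 0 := by omega
        simp [hi, hj]
    · intro i hi
      obtain rfl : i = 0 := by omega
      have hC : ContDiffOn ℝ 1 (fun t => Φ (α t)) (ball 0 δ) := by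
        rw [show (1 : WithTop ℕ∞) = 0 + 1 by simp, contDiffOn_succ_iff_deriv_of_isOpen isOpen_ball]
        refine ⟨fun t ht => (hball t ht).2.1.differentiableAt.differentiableWithinAt, by simp, ?_⟩
        rw [contDiffOn_zero]
        refine ContinuousOn.congr (f := fun t => X 0 (Φ (α t)))
          (fun t ht => (hball t ht).2.2.continuousWithinAt) fun t ht => (hball t ht).2.1.deriv
      simpa using hC.mono fun t ht => hmem t (by simpa using ht)
    · rw [ae_restrict_iff' measurableSet_Icc]
      refine ae_of_all _ fun t ht => ?_
      simpa using (hball t (hmem t ht)).2.1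

/-! ### Differentiation within a thin set along its tangent fields -/

/-- `ξ` is the velocity at `p` of a smooth curve in `M`. -/
def IsVelocity (M : Set C2) (p ξ : C2) : Prop :=
  ∃ γ : ℝ → C2, ContDiffAt ℝ ∞ γ 0 ∧ γ 0 = p ∧ HasDerivAt γ ξ 0 ∧ ∀ᶠ s in 𝓝 0, γ s ∈ M

section Calculus

variable {V : Type*} [NormedAddCommGroup V] [NormedSpace ℝ V] {M : Set C2} {Y : C2 → C2} {p : C2}

/-- Any derivative within `M` computes the derivative of `f` along a curve in `M` by the chain rule.
Hence all of them agree on velocities, whichever one `fderivWithin` selects. -/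
lemma HasFDerivWithinAt.along_eq {f : C2 → V} {f' : C2 →L[ℝ] V}
    (hf : HasFDerivWithinAt f f' M p) (hv : IsVelocity M p (Y p)) : along M Y f p = f' (Y p) := by
  obtain ⟨γ, -, h0, hγ, hM⟩ := hv
  have h1 := hf.comp_hasDerivAt_of_eq (0 : ℝ) hγ hM h0.symm
  have h2 := hf.differentiableWithinAt.hasFDerivWithinAt.comp_hasDerivAt_of_eq (0 : ℝ) hγ hM h0.symm
  exact h2.unique h1

lemma along_ofReal_mul {θ : C2 → ℝ} {a : C2 → ℂ} (hθ : DifferentiableWithinAt ℝ θ M p)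
    (ha : DifferentiableWithinAt ℝ a M p) (hv : IsVelocity M p (Y p)) :
    along M Y (fun y => (θ y : ℂ) * a y) p
      = (θ p : ℂ) * along M Y a p + ((along M Y θ p : ℝ) : ℂ) * a p := by
  have h := hθ.hasFDerivWithinAt.smul ha.hasFDerivWithinAt
  have h' : HasFDerivWithinAt (fun y => (θ y : ℂ) * a y) _ M p :=
    h.congr (fun y _ => by simp) (by simp)
  rw [HasFDerivWithinAt.along_eq h' hv]
  simp [along]

variable {S : Set (C2 × ℝ)} {T : ℝ}

/-- Without unique differentiability on `S`, `fderivWithin` may fail to be regular. This supplies a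
local choice of derivative that is; the regularity of the time and tangential derivatives is read
off from it. -/
lemma exists_local_fderivWithin {n : ℕ} {F : C2 × ℝ → V} {q : C2 × ℝ} (hq : q ∈ S)
    (hF : ContDiffOn ℝ (n + 1) F S) :
    ∃ F' : C2 × ℝ → (C2 × ℝ →L[ℝ] V),
      (∀ᶠ q' in 𝓝[S] q, HasFDerivWithinAt F (F' q') S q') ∧ ContDiffWithinAt ℝ n F' S q := by
  obtain ⟨u, hu, -, -, F', h, h'⟩ :=
    (contDiffWithinAt_succ_iff_hasFDerivWithinAt' (by simp)).mp (hF q hq)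
  rw [insert_eq_of_mem hq] at hu
  exact ⟨F', mem_of_superset hu h, h'⟩

lemma HasFDerivWithinAt.slice_space {I : Set ℝ} {F : C2 × ℝ → V} {L : C2 × ℝ →L[ℝ] V} {t : ℝ}
    (h : HasFDerivWithinAt F L (M ×ˢ I) (p, t)) (ht : t ∈ I) :
    HasFDerivWithinAt (fun y => F (y, t)) (L.comp (.inl ℝ C2 ℝ)) M p :=
  HasFDerivWithinAt.comp p h (hasFDerivAt_prodMk_left p t).hasFDerivWithinAt
    (fun y (hy : y ∈ M) => (⟨hy, ht⟩ : (y, t) ∈ M ×ˢ I))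

lemma HasFDerivWithinAt.slice_time {I : Set ℝ} {F : C2 × ℝ → V} {L : C2 × ℝ →L[ℝ] V} {t : ℝ}
    (h : HasFDerivWithinAt F L (M ×ˢ I) (p, t)) (hp : p ∈ M) :
    HasDerivWithinAt (fun s => F (p, s)) (L (0, 1)) I t := by
  have := h.comp t (hasFDerivAt_prodMk_right p t).hasFDerivWithinAt
    (fun s (hs : s ∈ I) => (⟨hp, hs⟩ : (p, s) ∈ M ×ˢ I))
  simpa [Function.comp_def] using HasFDerivWithinAt.hasDerivWithinAt this

lemma contDiffOn_derivWithin_time {n : ℕ} {F : C2 × ℝ → V} (hT : 0 < T)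
    (hF : ContDiffOn ℝ (n + 1) F (M ×ˢ Icc 0 T)) :
    ContDiffOn ℝ n (fun q : C2 × ℝ => derivWithin (fun s => F (q.1, s)) (Icc 0 T) q.2)
      (M ×ˢ Icc 0 T) := by
  intro q hq
  obtain ⟨F', h, h'⟩ := exists_local_fderivWithin hq hF
  have h1 : ContDiffWithinAt ℝ n (fun q' => F' q' (0, 1)) (M ×ˢ Icc 0 T) q :=
    h'.clm_apply contDiffWithinAt_const
  refine h1.congr_of_eventuallyEq_of_mem ?_ hq
  filter_upwards [h, self_mem_nhdsWithin] with q' h2 h3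
  exact (HasFDerivWithinAt.slice_time (p := q'.1) (t := q'.2) h2 h3.1).derivWithin
    (uniqueDiffOn_Icc hT _ h3.2)

lemma contDiffOn_along {n : ℕ} {F : C2 × ℝ → V} (hY : ContDiffOn ℝ n Y M)
    (hv : ∀ p ∈ M, IsVelocity M p (Y p)) (hF : ContDiffOn ℝ (n + 1) F (M ×ˢ Icc 0 T)) :
    ContDiffOn ℝ n (fun q : C2 × ℝ => along M Y (fun y => F (y, q.2)) q.1) (M ×ˢ Icc 0 T) := by
  intro q hq
  obtain ⟨F', h, h'⟩ := exists_local_fderivWithin hq hF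
  have hYq : ContDiffWithinAt ℝ n (fun q' : C2 × ℝ => (Y q'.1, (0 : ℝ))) (M ×ˢ Icc 0 T) q :=
    ((hY q.1 hq.1).comp q contDiffWithinAt_fst fun _ hx => hx.1).prodMk contDiffWithinAt_const
  refine (h'.clm_apply hYq).congr_of_eventuallyEq_of_mem ?_ hq
  filter_upwards [h, self_mem_nhdsWithin] with q' h2 h3
  simpa using HasFDerivWithinAt.along_eq
    (HasFDerivWithinAt.slice_space (p := q'.1) (t := q'.2) h2 h3.2) (hv _ h3.1)

/-- Derivatives in time and along a vector field on `M` commute. -/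
lemma hasDerivAt_along {F : C2 × ℝ → V} (hF : ContDiffOn ℝ 2 F (M ×ˢ Icc 0 T))
    (hv : ∀ p ∈ M, IsVelocity M p (Y p)) (hp : p ∈ M) {t : ℝ}
    (ht : t ∈ Ioo 0 T) :
    HasDerivAt (fun τ => along M Y (fun y => F (y, τ)) p)
      (along M Y (fun y => derivWithin (fun s => F (y, s)) (Icc 0 T) t) p) t := by
  have hT : 0 < T := ht.1.trans ht.2
  have htI : t ∈ Icc 0 T := Ioo_subset_Icc_self ht
  have hv' := hv p hp
  obtain ⟨γ, hγC, h0, hγ, hM⟩ := hv p hp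
  have hF2 : ContDiffOn ℝ ((1 : ℕ) + 1) F (M ×ˢ Icc 0 T) := by
    norm_num; exact hF
  set G : ℝ × ℝ → V := fun x => F (γ x.1, x.2) with hG
  have hmem : ∀ᶠ x : ℝ × ℝ in 𝓝 (0, t), γ x.1 ∈ M ∧ x.2 ∈ Ioo 0 T :=
    ((continuous_fst.tendsto ((0 : ℝ), t)).eventually hM).and
      ((continuous_snd.tendsto ((0 : ℝ), t)).eventually (Ioo_mem_nhds ht.1 ht.2))
  have hGC : ContDiffAt ℝ 2 G (0, t) := by
    have h1 : ContDiffWithinAt ℝ 2 F (M ×ˢ Icc 0 T) (γ (0, t).1, (0, t).2) := by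
      refine hF _ ⟨?_, htI⟩
      simp only [h0]; exact hp
    have h2 : ContDiffAt ℝ 2 (fun x : ℝ × ℝ => (γ x.1, x.2)) (0, t) :=
      ((hγC.of_le (WithTop.coe_le_coe.mpr (le_top : (2 : ℕ∞) ≤ ⊤))).comp ((0 : ℝ), t) contDiffAt_fst).prodMk contDiffAt_snd
    refine (h1.comp_of_preimage_mem_nhdsWithin ((0 : ℝ), t) (s := univ) h2 ?_).contDiffAt univ_mem
    rw [nhdsWithin_univ]
    exact hmem.mono fun x hx => ⟨hx.1, Ioo_subset_Icc_self hx.2⟩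
  have hsymm := hGC.isSymmSndFDerivAt (by simp)
  have hGd : ∀ᶠ x in 𝓝 ((0 : ℝ), t), DifferentiableAt ℝ G x :=
    (hGC.eventually (by simp)).mono fun x h => h.differentiableAt (by simp)
  have hG' : HasFDerivAt (fderiv ℝ G) (fderiv ℝ (fderiv ℝ G) (0, t)) (0, t) :=
    ((hGC.fderiv_right (m := 1) (by norm_num)).differentiableAt (by simp)).hasFDerivAt
  -- the spatial derivative of `F` in terms of `G`
  have e1 : (fun τ => along M Y (fun y => F (y, τ)) p) =ᶠ[𝓝 t]
      fun τ => fderiv ℝ G (0, τ) (1, 0) := by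
    have hc : Tendsto (fun τ : ℝ => ((0 : ℝ), τ)) (𝓝 t) (𝓝 (0, t)) :=
      (Continuous.prodMk_right (0 : ℝ)).tendsto t
    filter_upwards [hc.eventually hGd, Ioo_mem_nhds ht.1 ht.2] with τ h1 h2
    have h3 : HasDerivAt (fun s => G (s, τ)) (fderiv ℝ G (0, τ) (1, 0)) 0 := by
      have := h1.hasFDerivAt.comp_hasDerivAt (0 : ℝ)
        ((hasDerivAt_id (0 : ℝ)).prodMk (hasDerivAt_const (0 : ℝ) τ))
      exact this
    have h4 : DifferentiableWithinAt ℝ (fun y => F (y, τ)) M p := by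
      obtain ⟨F', h, -⟩ :=
        exists_local_fderivWithin (mk_mem_prod hp (Ioo_subset_Icc_self h2)) hF2
      exact (HasFDerivWithinAt.slice_space
        (h.self_of_nhdsWithin (mk_mem_prod hp (Ioo_subset_Icc_self h2)))
          (Ioo_subset_Icc_self h2)).differentiableWithinAt
    exact (h4.hasFDerivWithinAt.comp_hasDerivAt_of_eq (0 : ℝ) hγ hM h0.symm).unique h3
  have d1 : HasDerivAt (fun τ => fderiv ℝ G (0, τ) (1, 0))
      (fderiv ℝ (fderiv ℝ G) (0, t) (0, 1) (1, 0)) t := by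
    have := hG'.comp_hasDerivAt t ((hasDerivAt_const t (0 : ℝ)).prodMk (hasDerivAt_id t))
    simpa using this.clm_apply (hasDerivAt_const t ((1 : ℝ), (0 : ℝ)))
  -- the time derivative of `F` in terms of `G`
  have e2 : (fun s => derivWithin (fun τ => F (γ s, τ)) (Icc 0 T) t) =ᶠ[𝓝 0]
      fun s => fderiv ℝ G (s, t) (0, 1) := by
    have hc : Tendsto (fun s : ℝ => (s, t)) (𝓝 0) (𝓝 (0, t)) :=
      (Continuous.prodMk_left t).tendsto 0
    filter_upwards [hc.eventually hGd] with s h1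
    have h3 : HasDerivAt (fun τ => G (s, τ)) (fderiv ℝ G (s, t) (0, 1)) t :=
      h1.hasFDerivAt.comp_hasDerivAt t ((hasDerivAt_const t s).prodMk (hasDerivAt_id t))
    exact h3.hasDerivWithinAt.derivWithin (uniqueDiffOn_Icc hT _ htI)
  have d2 : HasDerivAt (fun s => fderiv ℝ G (s, t) (0, 1))
      (fderiv ℝ (fderiv ℝ G) (0, t) (1, 0) (0, 1)) 0 := by
    have := hG'.comp_hasDerivAt (0 : ℝ) ((hasDerivAt_id (0 : ℝ)).prodMk (hasDerivAt_const (0 : ℝ) t))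
    simpa using this.clm_apply (hasDerivAt_const (0 : ℝ) ((0 : ℝ), (1 : ℝ)))
  have h5 : DifferentiableWithinAt ℝ
      (fun y => derivWithin (fun s => F (y, s)) (Icc 0 T) t) M p := by
    have hC := contDiffOn_derivWithin_time hT hF2
    have := (hC (p, t) ⟨hp, htI⟩).differentiableWithinAt (by simp)
    exact (HasFDerivWithinAt.slice_space this.hasFDerivWithinAt htI).differentiableWithinAt
  have h6 := h5.hasFDerivWithinAt.comp_hasDerivAt_of_eq (0 : ℝ) hγ hM h0.symm
  have h7 : along M Y (fun y => derivWithin (fun s => F (y, s)) (Icc 0 T) t) p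
      = fderiv ℝ (fderiv ℝ G) (0, t) (0, 1) (1, 0) := by
    rw [hsymm (0, 1) (1, 0)]
    exact h6.unique (d2.congr_of_eventuallyEq e2)
  rw [h7]
  exact d1.congr_of_eventuallyEq e1

end Calculus

/-! ### Integrals over a compact set depending on time -/

section Integration

variable {M : Set C2} {μ : Measure C2} {T : ℝ}

lemma ContinuousOn.integrableOn_of_measure_lt_top {V : Type*} [NormedAddCommGroup V] {f : C2 → V}
    (hf : ContinuousOn f M) (hM : IsCompact M) (hμ : μ M < ⊤) : IntegrableOn f M μ := by
  obtain ⟨C, hC⟩ := hM.exists_bound_of_continuousOn hf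
  have : IsFiniteMeasure (μ.restrict M) := ⟨by simpa using hμ⟩
  exact Integrable.of_bound (hf.aestronglyMeasurable_of_isCompact hM hM.measurableSet) C
    ((ae_restrict_iff' hM.measurableSet).mpr (ae_of_all _ hC))

lemma continuousOn_setIntegral_of_isCompact {f : C2 × ℝ → ℝ} (hM : IsCompact M) (hμ : μ M < ⊤)
    (hf : ContinuousOn f (M ×ˢ Icc 0 T)) :
    ContinuousOn (fun t => ∫ y in M, f (y, t) ∂μ) (Icc 0 T) := by
  obtain ⟨C, hC⟩ := (hM.prod isCompact_Icc).exists_bound_of_continuousOn hf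
  have hslice : ∀ t ∈ Icc 0 T, ContinuousOn (fun y => f (y, t)) M := fun t ht =>
    hf.comp (by fun_prop) fun y hy => ⟨hy, ht⟩
  refine continuousOn_of_dominated (bound := fun _ => C) ?_ ?_ ?_ ?_
  · exact fun t ht => (hslice t ht).aestronglyMeasurable_of_isCompact hM hM.measurableSet
  · exact fun t ht => (ae_restrict_iff' hM.measurableSet).mpr (ae_of_all _ fun y hy => hC _ ⟨hy, ht⟩)
  · exact integrableOn_const hμ.ne
  · exact (ae_restrict_iff' hM.measurableSet).mpr (ae_of_all _ fun y hy =>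
      hf.comp (by fun_prop) fun t ht => ⟨hy, ht⟩)

lemma hasDerivAt_setIntegral_of_contDiffOn {f : C2 × ℝ → ℝ} (hM : IsCompact M) (hμ : μ M < ⊤)
    (hf : ContDiffOn ℝ 1 f (M ×ˢ Icc 0 T)) {t : ℝ} (ht : t ∈ Ioo 0 T) :
    HasDerivAt (fun t => ∫ y in M, f (y, t) ∂μ)
      (∫ y in M, derivWithin (fun s => f (y, s)) (Icc 0 T) t ∂μ) t := by
  have hT : 0 < T := ht.1.trans ht.2
  have hfc := hf.continuousOn
  have hf' : ContinuousOn (fun q : C2 × ℝ => derivWithin (fun s => f (q.1, s)) (Icc 0 T) q.2)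
      (M ×ˢ Icc 0 T) :=
    (contDiffOn_derivWithin_time (n := 0) hT (by simpa using hf)).continuousOn
  have hslice : ∀ {g : C2 × ℝ → ℝ}, ContinuousOn g (M ×ˢ Icc 0 T) → ∀ t ∈ Icc 0 T,
      ContinuousOn (fun y => g (y, t)) M := fun hg t ht =>
    hg.comp (by fun_prop) fun y hy => ⟨hy, ht⟩
  obtain ⟨C, hC⟩ := (hM.prod isCompact_Icc).exists_bound_of_continuousOn hf'
  have htI := Ioo_subset_Icc_self ht
  refine (hasDerivAt_integral_of_dominated_loc_of_deriv_le (bound := fun _ => C)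
    (F := fun t y => f (y, t)) (F' := fun t y => derivWithin (fun s => f (y, s)) (Icc 0 T) t)
    (Ioo_mem_nhds ht.1 ht.2) ?_ ?_ ?_ ?_ ?_ ?_).2
  · filter_upwards [Ioo_mem_nhds ht.1 ht.2] with τ hτ
    exact (hslice hfc τ (Ioo_subset_Icc_self hτ)).aestronglyMeasurable_of_isCompact hM
      hM.measurableSet
  · exact ContinuousOn.integrableOn_of_measure_lt_top (hslice hfc t htI) hM hμ
  · exact (hslice hf' t htI).aestronglyMeasurable_of_isCompact hM hM.measurableSet
  · exact (ae_restrict_iff' hM.measurableSet).mpr (ae_of_all _ fun y hy τ hτ =>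
      hC (y, τ) ⟨hy, Ioo_subset_Icc_self hτ⟩)
  · exact integrableOn_const hμ.ne
  · refine (ae_restrict_iff' hM.measurableSet).mpr (ae_of_all _ fun y hy τ hτ => ?_)
    have h1 := (hf (y, τ) ⟨hy, Ioo_subset_Icc_self hτ⟩).differentiableWithinAt (by simp)
    have h2 := HasFDerivWithinAt.slice_time h1.hasFDerivWithinAt hy
    exact h2.differentiableWithinAt.hasDerivWithinAt.hasDerivAt (Icc_mem_nhds hτ.1 hτ.2)

end Integration

/-! ### The weighted energy identity -/

/-- A compact set of finite surface measure with two `C¹` fields that are tangent to it. -/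
structure IsCompactFramed (M : Set C2) (X : Fin 2 → C2 → C2) : Prop where
  compact : IsCompact M
  measure_lt_top : μH[3] M < ⊤
  contDiffOn : ∀ j, ContDiffOn ℝ 1 (X j) M
  isVelocity : ∀ j, ∀ p ∈ M, IsVelocity M p (X j p)

section Energy

variable {M : Set C2} {X : Fin 2 → C2 → C2} {w : C2 → ℝ} {T : ℝ} {u : C2 → ℝ → ℂ}

/-- The energy density `|∂_t u|² + |∂̄_b u|²`. -/
noncomputable def energyDensity (M : Set C2) (X : Fin 2 → C2 → C2) (T : ℝ) (u : C2 → ℝ → ℂ)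
    (q : C2 × ℝ) : ℝ :=
  ‖timeDeriv T u q.1 q.2‖ ^ 2 + ‖dbarb M X (fun y => u y q.2) q.1‖ ^ 2

lemma IsWaveSolution.contDiffOn_timeDeriv (hu : IsWaveSolution M X w T u) (hT : 0 < T) :
    ContDiffOn ℝ 1 (fun q : C2 × ℝ => timeDeriv T u q.1 q.2) (M ×ˢ Icc 0 T) :=
  contDiffOn_derivWithin_time (n := 1) (F := fun q => u q.1 q.2) hT (by norm_num; exact hu.1)

lemma contDiffOn_dbarb {n : ℕ} {F : C2 × ℝ → ℂ} (hX : ∀ j, ContDiffOn ℝ n (X j) M)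
    (hv : ∀ j, ∀ p ∈ M, IsVelocity M p (X j p)) (hF : ContDiffOn ℝ (n + 1) F (M ×ˢ Icc 0 T)) :
    ContDiffOn ℝ n (fun q : C2 × ℝ => dbarb M X (fun y => F (y, q.2)) q.1) (M ×ˢ Icc 0 T) :=
  (contDiffOn_along (hX 0) (hv 0) hF).add
    (contDiffOn_const.mul (contDiffOn_along (hX 1) (hv 1) hF))

lemma IsWaveSolution.contDiffOn_dbarb (hu : IsWaveSolution M X w T u) (hM : IsCompactFramed M X) :
    ContDiffOn ℝ 1 (fun q : C2 × ℝ => dbarb M X (fun y => u y q.2) q.1) (M ×ˢ Icc 0 T) :=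
  KohnWave.contDiffOn_dbarb (n := 1) (F := fun q => u q.1 q.2) hM.contDiffOn hM.isVelocity
    (by norm_num; exact hu.1)

lemma IsWaveSolution.contDiffOn_energyDensity (hu : IsWaveSolution M X w T u) (hT : 0 < T)
    (hM : IsCompactFramed M X) :
    ContDiffOn ℝ 1 (energyDensity M X T u) (M ×ˢ Icc 0 T) :=
  ((hu.contDiffOn_timeDeriv hT).norm_sq ℝ).add ((hu.contDiffOn_dbarb hM).norm_sq ℝ)

lemma ContDiffOn.slice_space {V : Type*} [NormedAddCommGroup V] [NormedSpace ℝ V]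
    {n : WithTop ℕ∞} {F : C2 × ℝ → V} {I : Set ℝ} (hF : ContDiffOn ℝ n F (M ×ˢ I)) {t : ℝ}
    (ht : t ∈ I) : ContDiffOn ℝ n (fun y => F (y, t)) M :=
  hF.comp (contDiffOn_id.prodMk contDiffOn_const) fun _ hy => mk_mem_prod hy ht

lemma ContDiffOn.slice_time {V : Type*} [NormedAddCommGroup V] [NormedSpace ℝ V]
    {n : WithTop ℕ∞} {F : C2 × ℝ → V} {I : Set ℝ} (hF : ContDiffOn ℝ n F (M ×ˢ I)) {p : C2}
    (hp : p ∈ M) : ContDiffOn ℝ n (fun t => F (p, t)) I :=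
  hF.comp (contDiffOn_const.prodMk contDiffOn_id) fun _ ht => mk_mem_prod hp ht

lemma dbarb_ofReal_mul {θ : C2 → ℝ} {a : C2 → ℂ} {p : C2}
    (hv : ∀ j, IsVelocity M p (X j p)) (hθ : DifferentiableWithinAt ℝ θ M p)
    (ha : DifferentiableWithinAt ℝ a M p) :
    dbarb M X (fun y => (θ y : ℂ) * a y) p = (θ p : ℂ) * dbarb M X a p
      + (((along M (X 0) θ p : ℝ) : ℂ) + Complex.I * ((along M (X 1) θ p : ℝ) : ℂ)) * a p := by
  unfold dbarb
  rw [along_ofReal_mul hθ ha (hv 0), along_ofReal_mul hθ ha (hv 1)]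
  ring

/-- The derivative of the energy with weight `θ`, up to the factor `1 / 2`. -/
lemma IsWaveSolution.hasDerivAt_energy (hu : IsWaveSolution M X w T u)
    (hM : IsCompactFramed M X) (hw : ContDiffOn ℝ 1 w M) {θ : C2 × ℝ → ℝ}
    (hθ : ContDiffOn ℝ 1 θ (M ×ˢ Icc 0 T)) {t : ℝ} (ht : t ∈ Ioo 0 T) :
    let A : C2 → ℝ := fun y => (derivWithin (fun s => θ (y, s)) (Icc 0 T) t
        * energyDensity M X T u (y, t)
      - 2 * (dbarb M X (fun y => u y t) y * starRingEnd ℂ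
          ((((along M (X 0) (fun y => θ (y, t)) y : ℝ) : ℂ)
            + Complex.I * ((along M (X 1) (fun y => θ (y, t)) y : ℝ) : ℂ))
            * timeDeriv T u y t)).re) * w y
    IntegrableOn A M μH[3] ∧
    HasDerivAt (fun t => ∫ y in M, θ (y, t) * energyDensity M X T u (y, t) * w y ∂μH[3])
      (∫ y in M, A y ∂μH[3]) t := by
  intro A
  have hT : 0 < T := ht.1.trans ht.2
  have htI := Ioo_subset_Icc_self ht
  have hc := hM.compact
  have hμ := hM.measure_lt_top
  have ha := hu.contDiffOn_timeDeriv hT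
  have hb := hu.contDiffOn_dbarb hM
  have he := hu.contDiffOn_energyDensity hT hM
  have hat : ContDiffOn ℝ 1 (fun y => timeDeriv T u y t) M := ContDiffOn.slice_space ha htI
  have hbt : ContDiffOn ℝ 1 (fun y => dbarb M X (fun y => u y t) y) M :=
    ContDiffOn.slice_space hb htI
  have hθt : ContDiffOn ℝ 1 (fun y => θ (y, t)) M := ContDiffOn.slice_space hθ htI
  have hatt : ContinuousOn (fun y => timeDeriv T (timeDeriv T u) y t) M :=
    (ContDiffOn.slice_space (contDiffOn_derivWithin_time (n := 0)
      (F := fun q : C2 × ℝ => timeDeriv T u q.1 q.2) hT (by simpa using ha)) htI).continuousOn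
  have hθd : ContinuousOn (fun y => derivWithin (fun s => θ (y, s)) (Icc 0 T) t) M :=
    (ContDiffOn.slice_space (contDiffOn_derivWithin_time (n := 0) hT (by simpa using hθ))
      htI).continuousOn
  have hθX : ∀ j, ContinuousOn (fun y => along M (X j) (fun y => θ (y, t)) y) M := fun j =>
    (ContDiffOn.slice_space (contDiffOn_along (n := 0) ((hM.contDiffOn j).of_le (by simp))
      (hM.isVelocity j) (by simpa using hθ)) htI).continuousOn
  have hdba : ContinuousOn (fun y => dbarb M X (fun y => timeDeriv T u y t) y) M :=
    (ContDiffOn.slice_space (KohnWave.contDiffOn_dbarb (n := 0)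
      (F := fun q : C2 × ℝ => timeDeriv T u q.1 q.2)
      (fun j => (hM.contDiffOn j).of_le (by simp))
      hM.isVelocity (by simpa using ha)) htI).continuousOn
  set a : C2 → ℂ := fun y => timeDeriv T u y t
  set b : C2 → ℂ := fun y => dbarb M X (fun y => u y t) y
  set Zθ : C2 → ℂ := fun y => ((along M (X 0) (fun y => θ (y, t)) y : ℝ) : ℂ)
            + Complex.I * ((along M (X 1) (fun y => θ (y, t)) y : ℝ) : ℂ)
  have hZθc : ContinuousOn Zθ M :=
    (Complex.continuous_ofReal.comp_continuousOn (hθX 0)).add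
      (continuousOn_const.mul (Complex.continuous_ofReal.comp_continuousOn (hθX 1)))
  have hac := hat.continuousOn
  have hbc := hbt.continuousOn
  have hwc := hw.continuousOn
  have hec : ContinuousOn (fun y => energyDensity M X T u (y, t)) M :=
    (ContDiffOn.slice_space he htI).continuousOn
  have hθc := hθt.continuousOn
  have hAc : ContinuousOn A M := by
    refine ContinuousOn.mul (ContinuousOn.sub (hθd.mul hec) (continuousOn_const.mul ?_)) hwc
    exact Complex.continuous_re.comp_continuousOn
      (hbc.mul (Complex.continuous_conj.comp_continuousOn (hZθc.mul hac)))
  have hAi := ContinuousOn.integrableOn_of_measure_lt_top hAc hc hμ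
  refine ⟨hAi, ?_⟩
  -- the weak form of the equation, tested with `θ ∂_t u`
  set Φ : C2 → ℂ := fun y => (θ (y, t) : ℂ) * a y
  have hΦ : ContDiffOn ℝ 1 Φ M := (Complex.ofRealCLM.contDiff.comp_contDiffOn hθt).mul hat
  have hdΦ : ∀ y ∈ M, dbarb M X Φ y = (θ (y, t) : ℂ) * dbarb M X a y + Zθ y * a y := fun y hy =>
    dbarb_ofReal_mul (fun j => hM.isVelocity j y hy)
      ((hθt y hy).differentiableWithinAt (by simp)) ((hat y hy).differentiableWithinAt (by simp))
  have hweak := ((hu.2 t htI).2 Φ hΦ)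
  unfold pairing at hweak
  set att : C2 → ℂ := fun y => timeDeriv T (timeDeriv T u) y t
  -- `B` is the integrand of the weak equation with everything on one side and `∂̄_b Φ` expanded by
  -- the product rule, so its integral vanishes.
  let B : C2 → ℂ := fun y => att y * starRingEnd ℂ (Φ y) * (w y : ℂ)
    + b y * starRingEnd ℂ ((θ (y, t) : ℂ) * dbarb M X a y + Zθ y * a y) * (w y : ℂ)
  have hwC : ContinuousOn (fun y => (w y : ℂ)) M := Complex.continuous_ofReal.comp_continuousOn hwc
  have hB1 : ContinuousOn (fun y => att y * starRingEnd ℂ (Φ y) * (w y : ℂ)) M :=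
    (hatt.mul (Complex.continuous_conj.comp_continuousOn hΦ.continuousOn)).mul hwC
  have hB2 : ContinuousOn (fun y => b y * starRingEnd ℂ ((θ (y, t) : ℂ) * dbarb M X a y
      + Zθ y * a y) * (w y : ℂ)) M :=
    (hbc.mul (Complex.continuous_conj.comp_continuousOn
      (((Complex.continuous_ofReal.comp_continuousOn hθc).mul hdba).add (hZθc.mul hac)))).mul hwC
  have hBi : IntegrableOn B M μH[3] :=
    ContinuousOn.integrableOn_of_measure_lt_top (hB1.add hB2) hc hμ
  have hB0 : ∫ y in M, B y ∂μH[3] = 0 := by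
    rw [integral_add (ContinuousOn.integrableOn_of_measure_lt_top hB1 hc hμ)
      (ContinuousOn.integrableOn_of_measure_lt_top hB2 hc hμ)]
    have e1 : ∫ y in M, b y * starRingEnd ℂ ((θ (y, t) : ℂ) * dbarb M X a y
      + Zθ y * a y) * (w y : ℂ) ∂μH[3] = ∫ y in M, b y * starRingEnd ℂ (dbarb M X Φ y)
        * (w y : ℂ) ∂μH[3] := by
      refine setIntegral_congr_fun hc.measurableSet fun y hy => ?_
      simp only [hdΦ y hy]
    rw [e1, ← hweak, ← integral_add (ContinuousOn.integrableOn_of_measure_lt_top hB1 hc hμ)]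
    · simp [att]
    · have h := (ContinuousOn.integrableOn_of_measure_lt_top hB1 hc hμ).neg
      refine h.congr_fun (fun y _ => ?_) hc.measurableSet
      simp [att]
  have hBre : ∫ y in M, (B y).re ∂μH[3] = 0 := by
    have := integral_re (𝕜 := ℂ) hBi
    simp only [RCLike.re_eq_complex_re] at this
    rw [this, hB0]; simp
  have hder := hasDerivAt_setIntegral_of_contDiffOn (T := T) hc hμ
    (f := fun q => θ q * energyDensity M X T u q * w q.1)
    ((hθ.mul he).mul (hw.comp contDiffOn_fst fun q hq => hq.1)) ht
  convert hder using 1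
  -- Differentiating the energy density produces `2 θ Re(u_tt ū_t + ∂̄_b u · conj(∂̄_b u_t))`. This
  -- is the part of `2 Re B` free of `Zθ`; the `Zθ` part is compensated by the flux in `A`.
  have hpt : ∀ y ∈ M, derivWithin (fun s => θ (y, s) * energyDensity M X T u (y, s) * w y)
      (Icc 0 T) t = A y + 2 * (B y).re := by
    intro y hy
    have hnhds : Icc 0 T ∈ 𝓝 t := Icc_mem_nhds ht.1 ht.2
    have dθ : HasDerivAt (fun s => θ (y, s)) (derivWithin (fun s => θ (y, s)) (Icc 0 T) t) t :=
      (((ContDiffOn.slice_time hθ hy) t htI).differentiableWithinAt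
        (by simp)).hasDerivWithinAt.hasDerivAt hnhds
    have da : HasDerivAt (fun s => timeDeriv T u y s) (att y) t :=
      (((ContDiffOn.slice_time ha hy) t htI).differentiableWithinAt
        (by simp)).hasDerivWithinAt.hasDerivAt hnhds
    have db : HasDerivAt (fun s => dbarb M X (fun y => u y s) y) (dbarb M X a y) t := by
      have h := fun j => KohnWave.hasDerivAt_along (F := fun q => u q.1 q.2) hu.1
        (hM.isVelocity j) hy ht
      exact (h 0).add ((h 1).const_mul Complex.I)
    have hd := ((dθ.mul (da.norm_sq.add db.norm_sq)).mul_const (w y))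
    have := hd.hasDerivWithinAt.derivWithin (uniqueDiffOn_Icc hT t htI)
    refine Eq.trans this ?_
    simp only [A, B, Φ, a, b, att, Zθ, Pi.add_apply, energyDensity, Complex.inner, Complex.I_re,
      Complex.I_im, Complex.add_re, Complex.mul_re, Complex.mul_im,
      Complex.conj_re, Complex.conj_im, Complex.ofReal_re, Complex.ofReal_im, Complex.add_im,
      map_add, map_mul]
    ring
  rw [setIntegral_congr_fun hc.measurableSet hpt]
  have hBi' : IntegrableOn (fun y => 2 * (B y).re) M μH[3] := hBi.re.const_mul 2
  rw [integral_add hAi hBi', integral_const_mul, hBre]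
  simp

end Energy

/-! ### Cutoffs at the vertex and the weight of the light cone -/

/-- Smooth cutoff functions around a point, with gradient of the order of the inverse radius. -/
lemma exists_cutoff (x₀ : C2) : ∃ C : ℝ, 0 ≤ C ∧ ∀ ε > 0, ∃ κ : C2 → ℝ, ContDiff ℝ 1 κ ∧
    (∀ y, 0 ≤ κ y) ∧ (∀ y, κ y ≤ 1) ∧ (∀ᶠ y in 𝓝 x₀, κ y = 0) ∧
    (∀ y ∉ closedBall x₀ (2 * ε), κ y = 1) ∧ (∀ y, ‖fderiv ℝ κ y‖ ≤ C / ε) ∧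
    ∀ y ∉ closedBall x₀ (2 * ε), fderiv ℝ κ y = 0 := by
  -- The profile vanishes on the unit ball and equals `1` once `‖z‖² ≥ 2`, in particular outside the
  -- ball of radius `2`. Rescaling by `ε⁻¹` gives the gradient bound `C / ε`.
  let g : C2 → ℝ := fun z => Real.smoothTransition (‖z‖ ^ 2 - 1)
  have hg : ContDiff ℝ 1 g :=
    (Real.smoothTransition.contDiff (n := 1)).comp ((contDiff_norm_sq ℝ).sub contDiff_const)
  have hg1 : ∀ z ∉ closedBall (0 : C2) 2, g =ᶠ[𝓝 z] fun _ => 1 := by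
    intro z hz
    filter_upwards [isClosed_closedBall.isOpen_compl.mem_nhds hz] with y hy
    have : 2 < ‖y‖ := by simpa using hy
    exact Real.smoothTransition.one_of_one_le (by nlinarith)
  have hg0 : ∀ᶠ z in 𝓝 (0 : C2), g z = 0 := by
    filter_upwards [ball_mem_nhds (0 : C2) one_pos] with z hz
    have : ‖z‖ < 1 := by simpa using hz
    exact Real.smoothTransition.zero_of_nonpos (by nlinarith [norm_nonneg z])
  have hgd : ∀ z ∉ closedBall (0 : C2) 2, fderiv ℝ g z = 0 := fun z hz => by
    rw [(hg1 z hz).fderiv_eq]; simp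
  obtain ⟨C, hC⟩ := (isCompact_closedBall (0 : C2) 2).exists_bound_of_continuousOn
    (hg.continuous_fderiv (by simp)).continuousOn
  have hC0 : 0 ≤ C := (norm_nonneg _).trans (hC 0 (by simp))
  have hC' : ∀ z, ‖fderiv ℝ g z‖ ≤ C := fun z => by
    by_cases hz : z ∈ closedBall (0 : C2) 2
    · exact hC z hz
    · rw [hgd z hz]; simpa using hC0
  refine ⟨C, hC0, fun ε hε => ⟨fun y => g (ε⁻¹ • (y - x₀)), ?_, fun y =>
    Real.smoothTransition.nonneg _, fun y => Real.smoothTransition.le_one _, ?_, ?_, ?_, ?_⟩⟩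
  · exact hg.comp (by fun_prop)
  · have : Tendsto (fun y => ε⁻¹ • (y - x₀)) (𝓝 x₀) (𝓝 0) := by
      have h : Continuous fun y => ε⁻¹ • (y - x₀) := by fun_prop
      simpa using h.tendsto x₀
    exact this.eventually hg0
  all_goals
    have hout : ∀ y ∉ closedBall x₀ (2 * ε), ε⁻¹ • (y - x₀) ∉ closedBall (0 : C2) 2 := by
      intro y hy
      rw [mem_closedBall, dist_eq_norm, not_le] at hy
      rw [mem_closedBall_zero_iff, norm_smul, norm_inv, Real.norm_of_nonneg hε.le, not_le,
        lt_inv_mul_iff₀ hε]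
      linarith
    have hfd : ∀ y, fderiv ℝ (fun y => g (ε⁻¹ • (y - x₀))) y
        = ε⁻¹ • fderiv ℝ g (ε⁻¹ • (y - x₀)) := by
      intro y
      have h1 : HasFDerivAt (fun y => ε⁻¹ • (y - x₀)) (ε⁻¹ • ContinuousLinearMap.id ℝ C2) y :=
        ((hasFDerivAt_id y).sub_const x₀).const_smul ε⁻¹
      have h2 := ((hg.differentiable (by simp)) (ε⁻¹ • (y - x₀))).hasFDerivAt.comp y h1
      refine h2.fderiv.trans ?_
      ext v; simp
  · exact fun y hy => (hg1 _ (hout y hy)).self_of_nhds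
  · intro y
    rw [hfd, norm_smul, norm_inv, Real.norm_of_nonneg hε.le, div_eq_inv_mul]
    exact mul_le_mul_of_nonneg_left (hC' _) (by positivity)
  · intro y hy
    rw [hfd, hgd _ (hout y hy), smul_zero]

section Weight

variable {M : Set C2} {X : Fin 2 → C2 → C2} {κ d₀ : C2 → ℝ} {x₀ : C2} {t₀ : ℝ}

/-- The weight `κ(y) η(t₀ - t - d₀(y))` of the local energy. -/
noncomputable def coneWeight (κ d₀ : C2 → ℝ) (t₀ : ℝ) (q : C2 × ℝ) : ℝ :=
  κ q.1 * expNegInvGlue (t₀ - q.2 - d₀ q.1)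

lemma contDiff_expNegInvGlue : ContDiff ℝ 1 expNegInvGlue :=
  expNegInvGlue.contDiff (n := 1)

lemma deriv_expNegInvGlue_nonneg (s : ℝ) : 0 ≤ deriv expNegInvGlue s :=
  expNegInvGlue.monotone.deriv_nonneg

lemma contDiffWithinAt_of_diff_singleton {d₀ : C2 → ℝ} (hd : ContDiffOn ℝ 1 d₀ (M \ {x₀})) {y : C2}
    (hy : y ∈ M) (hyx : y ≠ x₀) : ContDiffWithinAt ℝ 1 d₀ M y :=
  (hd y ⟨hy, hyx⟩).mono_of_mem_nhdsWithin
    (inter_mem self_mem_nhdsWithin (mem_nhdsWithin_of_mem_nhds (isOpen_ne.mem_nhds hyx)))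

/-- The only possible singularity of `d₀` is at `x₀`, and the factor `κ` vanishes in a neighborhood
of that point. -/
lemma contDiffOn_coneWeight (hκ : ContDiff ℝ 1 κ) (hκ0 : ∀ᶠ y in 𝓝 x₀, κ y = 0)
    (hd : ContDiffOn ℝ 1 d₀ (M \ {x₀})) (I : Set ℝ) :
    ContDiffOn ℝ 1 (coneWeight κ d₀ t₀) (M ×ˢ I) := by
  intro q hq
  by_cases hx : q.1 = x₀
  · have h0 : ∀ᶠ q' in 𝓝 q, coneWeight κ d₀ t₀ q' = 0 := by
      have := (continuous_fst.tendsto q).eventually (hx ▸ hκ0)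
      exact this.mono fun q' h => by simp [coneWeight, h]
    exact (contDiffWithinAt_const (c := (0 : ℝ))).congr_of_eventuallyEq
      (h0.filter_mono nhdsWithin_le_nhds) h0.self_of_nhds
  · have h1 : ContDiffWithinAt ℝ 1 (fun q' : C2 × ℝ => d₀ q'.1) (M ×ˢ I) q :=
      (contDiffWithinAt_of_diff_singleton hd hq.1 hx).comp q contDiffWithinAt_fst fun _ h => h.1
    have h2 : ContDiffWithinAt ℝ 1 (fun q' : C2 × ℝ => t₀ - q'.2 - d₀ q'.1) (M ×ˢ I) q :=
      (contDiffWithinAt_const.sub contDiffWithinAt_snd).sub h1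
    exact ((hκ.comp contDiff_fst).contDiffWithinAt).mul
      (contDiff_expNegInvGlue.contDiffAt.comp_contDiffWithinAt q h2)

lemma hasDerivAt_coneWeight (y : C2) (t : ℝ) :
    HasDerivAt (fun s => coneWeight κ d₀ t₀ (y, s))
      (-(κ y * deriv expNegInvGlue (t₀ - t - d₀ y))) t := by
  have h1 : HasDerivAt (fun s => t₀ - s - d₀ y) (-1) t := by
    simpa using ((hasDerivAt_id t).const_sub t₀).sub_const (d₀ y)
  have h2 := ((contDiff_expNegInvGlue.differentiable (by simp) (t₀ - t - d₀ y)).hasDerivAt.comp t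
    h1).const_mul (κ y)
  refine h2.congr_deriv ?_
  ring

lemma along_coneWeight (hκ : ContDiff ℝ 1 κ) (hd : ContDiffOn ℝ 1 d₀ (M \ {x₀})) {y : C2}
    (hy : y ∈ M) (hyx : y ≠ x₀) {Y : C2 → C2} (hv : IsVelocity M y (Y y)) (t : ℝ) :
    along M Y (fun y => coneWeight κ d₀ t₀ (y, t)) y
      = expNegInvGlue (t₀ - t - d₀ y) * fderiv ℝ κ y (Y y)
        - κ y * deriv expNegInvGlue (t₀ - t - d₀ y) * along M Y d₀ y := by
  have h1 := ((contDiffWithinAt_of_diff_singleton hd hy hyx).differentiableWithinAt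
    (by simp)).hasFDerivWithinAt.const_sub (t₀ - t)
  have h2 := (contDiff_expNegInvGlue.differentiable (by simp)
    (t₀ - t - d₀ y)).hasDerivAt.comp_hasFDerivWithinAt y h1
  have h3 := (hκ.differentiable (by simp) y).hasFDerivAt.hasFDerivWithinAt.mul h2
  have h4 := HasFDerivWithinAt.along_eq h3 hv
  refine Eq.trans h4 ?_
  simp [along]
  ring

lemma along_coneWeight_self (hκ0 : ∀ᶠ y in 𝓝 x₀, κ y = 0) {Y : C2 → C2}
    (hv : IsVelocity M x₀ (Y x₀)) (t : ℝ) :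
    along M Y (fun y => coneWeight κ d₀ t₀ (y, t)) x₀ = 0 := by
  have h : HasFDerivWithinAt (fun y => coneWeight κ d₀ t₀ (y, t)) (0 : C2 →L[ℝ] ℝ) M x₀ :=
    ((hasFDerivAt_const (0 : ℝ) x₀).congr_of_eventuallyEq
      (hκ0.mono fun y h => by simp [coneWeight, h])).hasFDerivWithinAt
  rw [HasFDerivWithinAt.along_eq h hv]; rfl

end Weight

/-! ### The flux estimate and vanishing inside the cone -/

/-- Here `k` is the cutoff, `s` and `s'` are the values of `η` and `η'`, and `Zk`, `Zd` are the `(X₁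
+ iX₂)`-derivatives of the cutoff and of the distance. Since `‖Zd‖ ≤ 1`, the flux through the cone
is at most `2 k s' ‖a‖ ‖b‖`, which the negative term absorbs. Only the flux caused by the cutoff is
left. -/
lemma energy_flux_le {a b Zk Zd : ℂ} {k s s' : ℝ} (hk : 0 ≤ k) (hs : 0 ≤ s) (hs' : 0 ≤ s')
    (hZd : ‖Zd‖ ≤ 1) :
    -(k * s') * (‖a‖ ^ 2 + ‖b‖ ^ 2)
        - 2 * (b * starRingEnd ℂ (((s : ℂ) * Zk - ((k * s' : ℝ) : ℂ) * Zd) * a)).re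
      ≤ 2 * (s * ‖Zk‖ * ‖b‖ * ‖a‖) := by
  have hks : 0 ≤ k * s' := mul_nonneg hk hs'
  have h1 : -(b * starRingEnd ℂ (((s : ℂ) * Zk - ((k * s' : ℝ) : ℂ) * Zd) * a)).re
      ≤ ‖b‖ * ((s * ‖Zk‖ + k * s') * ‖a‖) := by
    refine (neg_le_abs _).trans ((Complex.abs_re_le_norm _).trans ?_)
    rw [norm_mul, Complex.norm_conj, norm_mul]
    gcongr
    refine (norm_sub_le _ _).trans ?_
    rw [norm_mul, norm_mul, Complex.norm_real, Complex.norm_real, Real.norm_of_nonneg hs,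
      Real.norm_of_nonneg hks]
    nlinarith
  nlinarith [mul_nonneg hks (sq_nonneg (‖a‖ - ‖b‖))]

lemma dbarb_eq_zero_of_eventually {M : Set C2} {X : Fin 2 → C2 → C2} {f : C2 → ℂ} {p : C2}
    (hv : ∀ j, IsVelocity M p (X j p)) (h : ∀ᶠ y in 𝓝[M] p, f y = 0) (hp : f p = 0) :
    dbarb M X f p = 0 := by
  have h0 : HasFDerivWithinAt f (0 : C2 →L[ℝ] ℂ) M p :=
    (hasFDerivAt_const (0 : ℂ) p).hasFDerivWithinAt.congr_of_eventuallyEq h hp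
  simp [dbarb, HasFDerivWithinAt.along_eq h0 (hv _)]

section Propagation

variable {M : Set C2} {X : Fin 2 → C2 → C2} {w : C2 → ℝ} {T : ℝ} {u : C2 → ℝ → ℂ}
  {d₀ : C2 → ℝ} {x₀ : C2} {t₀ : ℝ}

/-- The remaining flux is at most `D / ε` and lives in the ball of radius `2ε`, whose measure is
`O(ε³)`. The energy starts at `0` and hence grows at a rate `O(ε²)` at most. It matters that `C` and
`δ` are chosen before `ε`. -/
lemma IsWaveSolution.exists_cutoff_energy_le (hu : IsWaveSolution M X w T u)
    (hM : IsCompactFramed M X) (hw : ContDiffOn ℝ 1 w M) (hw0 : ∀ p ∈ M, 0 < w p)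
    (hd : ContDiffOn ℝ 1 d₀ (M \ {x₀})) (hd0 : ∀ y ∈ M, 0 ≤ d₀ y)
    (hd1 : ∀ y ∈ M, y ≠ x₀ → |along M (X 0) d₀ y| + |along M (X 1) d₀ y| ≤ 1)
    (hball : ∃ C : ℝ, 0 ≤ C ∧ ∃ δ > 0, ∀ ε, 0 < ε → ε ≤ δ →
      μH[3] (M ∩ closedBall x₀ ε) ≤ ENNReal.ofReal (C * ε ^ 3))
    (hx₀ : x₀ ∈ M) (ht₀ : 0 < t₀) (ht₀T : t₀ ≤ T) (hu0 : ∀ y ∈ M, d₀ y ≤ t₀ → u y 0 = 0)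
    (hu1 : ∀ y ∈ M, d₀ y ≤ t₀ → timeDeriv T u y 0 = 0) :
    ∃ C : ℝ, ∃ δ > 0, ∀ ε, 0 < ε → ε ≤ δ → ∃ κ : C2 → ℝ, (∀ y, 0 ≤ κ y) ∧
      (∀ y ∉ closedBall x₀ (2 * ε), κ y = 1) ∧ ∀ t ∈ Icc 0 t₀,
      IntegrableOn (fun y => coneWeight κ d₀ t₀ (y, t) * energyDensity M X T u (y, t) * w y) M μH[3]
      ∧ ∫ y in M, coneWeight κ d₀ t₀ (y, t) * energyDensity M X T u (y, t) * w y ∂μH[3]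
        ≤ C * ε ^ 2 := by
  have hT : 0 < T := ht₀.trans_le ht₀T
  have hc := hM.compact
  have hμ := hM.measure_lt_top
  obtain ⟨Cb, hCb, δ, hδ, hball⟩ := hball
  obtain ⟨Cκ, hCκ, hcut⟩ := exists_cutoff x₀
  have he := hu.contDiffOn_energyDensity hT hM
  obtain ⟨Ka, hKa⟩ := (hc.prod isCompact_Icc).exists_bound_of_continuousOn
    (hu.contDiffOn_timeDeriv hT).continuousOn
  obtain ⟨Kb, hKb⟩ := (hc.prod isCompact_Icc).exists_bound_of_continuousOn
    (hu.contDiffOn_dbarb hM).continuousOn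
  obtain ⟨Kw, hKw⟩ := hc.exists_bound_of_continuousOn hw.continuousOn
  obtain ⟨KX, hKX⟩ := hc.exists_bound_of_continuousOn
    ((hM.contDiffOn 0).continuousOn.norm.add (hM.contDiffOn 1).continuousOn.norm)
  set D : ℝ := 2 * (expNegInvGlue t₀ * (Cκ * KX) * Kb * Ka) * Kw with hD
  have hKa0 : 0 ≤ Ka := (norm_nonneg _).trans (hKa (x₀, 0) ⟨hx₀, le_rfl, hT.le⟩)
  have hKb0 : 0 ≤ Kb := (norm_nonneg _).trans (hKb (x₀, 0) ⟨hx₀, le_rfl, hT.le⟩)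
  have hKw0 : 0 ≤ Kw := (norm_nonneg _).trans (hKw x₀ hx₀)
  have hKX0 : 0 ≤ KX := (norm_nonneg _).trans (hKX x₀ hx₀)
  have hη0 := expNegInvGlue.nonneg t₀
  have hD0 : 0 ≤ D := by positivity
  -- The ball estimate is used at radius `2ε`, hence `δ / 2` and `(2ε)³ / ε = 8 ε²`; the factor `t₀`
  -- comes from integrating in time.
  refine ⟨D * (8 * Cb) * t₀, δ / 2, by positivity, fun ε hε hεδ => ?_⟩
  have hDε : 0 ≤ D / ε := by positivity
  obtain ⟨κ, hκ, hκ0, hκ1, hκz, hκone, hκd, hκd0⟩ := hcut ε hε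
  have hθ := contDiffOn_coneWeight (t₀ := t₀) hκ hκz hd (Icc 0 T)
  have hfC : ContDiffOn ℝ 1 (fun q : C2 × ℝ =>
      coneWeight κ d₀ t₀ q * energyDensity M X T u q * w q.1) (M ×ˢ Icc 0 T) :=
    (hθ.mul he).mul (hw.comp contDiffOn_fst fun q hq => hq.1)
  have hsub : Icc 0 t₀ ⊆ Icc 0 T := Icc_subset_Icc_right ht₀T
  refine ⟨κ, hκ0, hκone, fun t ht => ⟨ContinuousOn.integrableOn_of_measure_lt_top
    (ContDiffOn.slice_space hfC (hsub ht)).continuousOn hc hμ, ?_⟩⟩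
  set E : ℝ → ℝ := fun t =>
    ∫ y in M, coneWeight κ d₀ t₀ (y, t) * energyDensity M X T u (y, t) * w y ∂μH[3] with hE
  have hE0 : E 0 = 0 := by
    rw [hE]
    refine (setIntegral_congr_fun hc.measurableSet (g := fun _ => (0 : ℝ)) fun y hy => ?_).trans
      (by simp)
    -- Outside the open base of the cone the weight vanishes. Inside it and off `x₀`, `u(·, 0)`
    -- vanishes on a whole neighborhood in `M`, so `∂̄_b u` vanishes too.
    rcases le_or_gt t₀ (d₀ y) with h | h
    · simp [coneWeight, expNegInvGlue.zero_of_nonpos (show t₀ - d₀ y ≤ 0 by linarith)]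
    · by_cases hyx : y = x₀
      · simp [coneWeight, hyx, hκz.self_of_nhds]
      · have hcy := (contDiffWithinAt_of_diff_singleton hd hy hyx).continuousWithinAt
        have hb : dbarb M X (fun y => u y 0) y = 0 := by
          refine dbarb_eq_zero_of_eventually (fun j => hM.isVelocity j y hy) ?_ (hu0 y hy h.le)
          filter_upwards [hcy.eventually_lt_const h, self_mem_nhdsWithin] with z hz hzM
          exact hu0 z hzM hz.le
        simp [energyDensity, hu1 y hy h.le, hb]
  have hEc : ContinuousOn E (Icc 0 t₀) :=
    (continuousOn_setIntegral_of_isCompact hc hμ hfC.continuousOn).mono hsub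
  have hEd : ∀ t ∈ Ioo 0 t₀, ∃ e', HasDerivAt E e' t ∧ e' ≤ D * (8 * Cb) * ε ^ 2 := by
    intro t ht
    have htT : t ∈ Ioo 0 T := ⟨ht.1, ht.2.trans_le ht₀T⟩
    have htI := Ioo_subset_Icc_self htT
    obtain ⟨hAi, hder⟩ := hu.hasDerivAt_energy hM hw hθ htT
    refine ⟨_, hder, ?_⟩
    have hind : IntegrableOn ((closedBall x₀ (2 * ε)).indicator fun _ => D / ε) M μH[3] :=
      (integrableOn_const hμ.ne).indicator isClosed_closedBall.measurableSet
    refine (setIntegral_mono_on hAi hind hc.measurableSet (fun y hy => ?_)).trans ?_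
    · have hw' := hw0 y hy
      rw [((hasDerivAt_coneWeight (κ := κ) (d₀ := d₀) (t₀ := t₀) y t).hasDerivWithinAt.derivWithin
        (uniqueDiffOn_Icc hT t htI))]
      by_cases hyx : y = x₀
      · subst hyx
        rw [along_coneWeight_self hκz (hM.isVelocity 0 y hy),
          along_coneWeight_self hκz (hM.isVelocity 1 y hy)]
        rw [indicator_of_mem (by simp [hε.le])]
        simpa [hκz.self_of_nhds] using hDε
      · rw [along_coneWeight hκ hd hy hyx (hM.isVelocity 0 y hy),
          along_coneWeight hκ hd hy hyx (hM.isVelocity 1 y hy)]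
        set s := expNegInvGlue (t₀ - t - d₀ y)
        set a := timeDeriv T u y t
        set b := dbarb M X (fun y => u y t) y
        have hs : 0 ≤ s := expNegInvGlue.nonneg _
        have hs1 : s ≤ expNegInvGlue t₀ := expNegInvGlue.monotone (by
          have := hd0 y hy; linarith [ht.1])
        set Zk : ℂ := (fderiv ℝ κ y (X 0 y) : ℂ) + Complex.I * (fderiv ℝ κ y (X 1 y) : ℂ)
        set Zd : ℂ := ((along M (X 0) d₀ y : ℝ) : ℂ) + Complex.I * ((along M (X 1) d₀ y : ℝ) : ℂ)
        have hnorm : ∀ x y : ℝ, ‖(x : ℂ) + Complex.I * (y : ℂ)‖ ≤ |x| + |y| := fun x y =>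
          (norm_add_le _ _).trans (by simp)
        have hZd : ‖Zd‖ ≤ 1 := (hnorm _ _).trans (hd1 y hy hyx)
        have hflux := energy_flux_le (a := a) (b := b) (Zk := Zk) (hκ0 y) hs
          (deriv_expNegInvGlue_nonneg (t₀ - t - d₀ y)) hZd
        have hZk : ‖Zk‖ ≤ (closedBall x₀ (2 * ε)).indicator (fun _ => Cκ / ε * KX) y := by
          by_cases hyb : y ∈ closedBall x₀ (2 * ε)
          · rw [indicator_of_mem hyb]
            refine (hnorm _ _).trans ?_
            have h1 := (fderiv ℝ κ y).le_opNorm (X 0 y)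
            have h2 := (fderiv ℝ κ y).le_opNorm (X 1 y)
            rw [Real.norm_eq_abs] at h1 h2
            have h3 := (le_abs_self _).trans (hKX y hy)
            have h3' : ‖X 0 y‖ + ‖X 1 y‖ ≤ KX := h3
            calc _ ≤ ‖fderiv ℝ κ y‖ * (‖X 0 y‖ + ‖X 1 y‖) := by linarith
              _ ≤ Cκ / ε * KX := mul_le_mul (hκd y) h3' (by positivity) (by positivity)
          · rw [indicator_of_notMem hyb]
            simp [Zk, hκd0 y hyb]
        have hle : 2 * (s * ‖Zk‖ * ‖b‖ * ‖a‖) * w y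
            ≤ (closedBall x₀ (2 * ε)).indicator (fun _ => D / ε) y := by
          have ha := hKa (y, t) ⟨hy, htI⟩
          have hb := hKb (y, t) ⟨hy, htI⟩
          have hwy := (le_abs_self _).trans (hKw y hy)
          by_cases hyb : y ∈ closedBall x₀ (2 * ε)
          · rw [indicator_of_mem hyb] at hZk ⊢
            calc 2 * (s * ‖Zk‖ * ‖b‖ * ‖a‖) * w y
                ≤ 2 * (expNegInvGlue t₀ * (Cκ / ε * KX) * Kb * Ka) * Kw := by gcongr
              _ = D / ε := by rw [hD]; ring
          · rw [indicator_of_notMem hyb] at hZk ⊢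
            rw [le_antisymm hZk (norm_nonneg _)]; simp
        refine le_trans ?_ hle
        refine mul_le_mul_of_nonneg_right (le_trans (le_of_eq ?_) hflux) hw'.le
        simp only [energyDensity, Zk, Zd]
        congr 4
        push_cast
        ring_nf
    · rw [setIntegral_indicator isClosed_closedBall.measurableSet, setIntegral_const, smul_eq_mul]
      have h1 := hball (2 * ε) (by positivity) (by linarith)
      have h2 : (μH[3] : Measure C2).real (M ∩ closedBall x₀ (2 * ε)) ≤ Cb * (2 * ε) ^ 3 :=
        ENNReal.toReal_le_of_le_ofReal (by positivity) h1
      calc _ ≤ Cb * (2 * ε) ^ 3 * (D / ε) := mul_le_mul_of_nonneg_right h2 hDε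
        _ = D * (8 * Cb) * ε ^ 2 := by field_simp; ring
  have hbound := (convex_Icc 0 t₀).image_sub_le_mul_sub_of_deriv_le hEc
    (by
      rw [interior_Icc]
      intro t ht
      obtain ⟨e', h, -⟩ := hEd t ht
      exact h.differentiableAt.differentiableWithinAt)
    (C := D * (8 * Cb) * ε ^ 2)
    (by
      rw [interior_Icc]
      intro t ht
      obtain ⟨e', h, h'⟩ := hEd t ht
      rwa [h.deriv]) 0 ⟨le_rfl, ht₀.le⟩ t ht ht.1
  rw [hE0, sub_zero, sub_zero] at hbound
  calc E t ≤ D * (8 * Cb) * ε ^ 2 * t := hbound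
    _ ≤ D * (8 * Cb) * ε ^ 2 * t₀ := mul_le_mul_of_nonneg_left ht.2 (by positivity)
    _ = D * (8 * Cb) * t₀ * ε ^ 2 := by ring

/-- The solution has vanishing velocity inside the cone, away from the vertical line over `x₀`. -/
lemma IsWaveSolution.timeDeriv_eq_zero (hu : IsWaveSolution M X w T u)
    (hM : IsCompactFramed M X) (hw : ContDiffOn ℝ 1 w M) (hw0 : ∀ p ∈ M, 0 < w p)
    (hpos : ∀ p ∈ M, ∀ V ∈ 𝓝[M] p, 0 < μH[3] (M ∩ V))
    (hd : ContDiffOn ℝ 1 d₀ (M \ {x₀})) (hd0 : ∀ y ∈ M, 0 ≤ d₀ y)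
    (hd1 : ∀ y ∈ M, y ≠ x₀ → |along M (X 0) d₀ y| + |along M (X 1) d₀ y| ≤ 1)
    (hball : ∃ C : ℝ, 0 ≤ C ∧ ∃ δ > 0, ∀ ε, 0 < ε → ε ≤ δ →
      μH[3] (M ∩ closedBall x₀ ε) ≤ ENNReal.ofReal (C * ε ^ 3))
    (hx₀ : x₀ ∈ M) (ht₀ : 0 < t₀) (ht₀T : t₀ ≤ T) (hu0 : ∀ y ∈ M, d₀ y ≤ t₀ → u y 0 = 0)
    (hu1 : ∀ y ∈ M, d₀ y ≤ t₀ → timeDeriv T u y 0 = 0)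
    {t : ℝ} (ht : t ∈ Icc 0 t₀) {y : C2} (hy : y ∈ M) (hyx : y ≠ x₀) (hyt : d₀ y < t₀ - t) :
    timeDeriv T u y t = 0 := by
  by_contra hne
  have hT : 0 < T := ht₀.trans_le ht₀T
  have hc := hM.compact
  have htT : t ∈ Icc 0 T := ⟨ht.1, ht.2.trans ht₀T⟩
  obtain ⟨C, δ, hδ, hC⟩ := hu.exists_cutoff_energy_le hM hw hw0 hd hd0 hd1 hball hx₀ ht₀ ht₀T hu0 hu1
  set f : C2 → ℝ := fun z => expNegInvGlue (t₀ - t - d₀ z) * energyDensity M X T u (z, t) * w z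
  have hf0 : 0 < f y := by
    refine mul_pos (mul_pos (expNegInvGlue.pos_of_pos (by linarith)) ?_) (hw0 y hy)
    have : 0 < ‖timeDeriv T u y t‖ := norm_pos_iff.mpr hne
    simp only [energyDensity]
    positivity
  have hfc : ContinuousWithinAt f M y := by
    have h1 := (contDiffWithinAt_of_diff_singleton hd hy hyx).continuousWithinAt
    have h2 : ContinuousWithinAt (fun z => energyDensity M X T u (z, t)) M y :=
      (ContDiffOn.slice_space (hu.contDiffOn_energyDensity hT hM) htT).continuousOn y hy
    exact ((contDiff_expNegInvGlue.continuous.continuousAt.comp_continuousWithinAt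
      (continuousWithinAt_const.sub h1)).mul h2).mul (hw.continuousOn y hy)
  obtain ⟨c, hc0, hcf⟩ := exists_between hf0
  obtain ⟨ρ, hρ, hρV⟩ := Metric.mem_nhdsWithin_iff.mp (hfc.eventually_const_lt hcf)
  -- With `ε ≤ dist y x₀ / 8`, points within `σ` of `y` lie farther than `2ε` from `x₀`, so the
  -- cutoff equals `1` there.
  set σ := min (ρ / 2) (dist y x₀ / 2) with hσ
  have hyx' : 0 < dist y x₀ := dist_pos.mpr hyx
  have hσ0 : 0 < σ := by positivity
  set V := closedBall y σ
  have hV : ∀ z ∈ M ∩ V, c ≤ f z := fun z hz => by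
    refine le_of_lt (hρV ⟨?_, hz.1⟩)
    have h1 : dist z y ≤ σ := hz.2
    have h2 := min_le_left (ρ / 2) (dist y x₀ / 2)
    exact mem_ball.mpr (by linarith)
  have hVm : MeasurableSet (M ∩ V) := hc.measurableSet.inter isClosed_closedBall.measurableSet
  have hm0 : μH[3] (M ∩ V) ≠ ⊤ := (measure_mono inter_subset_left).trans_lt hM.measure_lt_top |>.ne
  have hm : 0 < (μH[3] : Measure C2).real (M ∩ V) :=
    ENNReal.toReal_pos (hpos y hy V (mem_nhdsWithin_of_mem_nhds (closedBall_mem_nhds y hσ0))).ne' hm0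
  have hlow : ∀ ε, 0 < ε → ε ≤ min δ (dist y x₀ / 8) →
      (μH[3] : Measure C2).real (M ∩ V) * c ≤ C * ε ^ 2 := by
    intro ε hε hεδ
    obtain ⟨κ, hκ0, hκ1, hκ⟩ := hC ε hε (hεδ.trans (min_le_left _ _))
    obtain ⟨hint, hle⟩ := hκ t ht
    refine le_trans ?_ hle
    refine le_trans ?_ (setIntegral_mono_set hint
      ((ae_restrict_iff' hc.measurableSet).mpr (ae_of_all _ fun z hz => ?_))
      (inter_subset_left (t := V)).eventuallyLE)
    · rw [← smul_eq_mul, ← setIntegral_const]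
      refine setIntegral_mono_on (integrableOn_const hm0) (hint.mono_set inter_subset_left) hVm ?_
      intro z hz
      have hκz : κ z = 1 := hκ1 z fun hzb => by
        have h1 : dist z y ≤ σ := hz.2
        have h2 : dist z x₀ ≤ 2 * ε := hzb
        have h3 := min_le_right (ρ / 2) (dist y x₀ / 2)
        have h4 := hεδ.trans (min_le_right _ _)
        have h5 := dist_triangle_left y x₀ z
        linarith
      simpa [coneWeight, hκz] using hV z hz
    · have h1 := hκ0 z
      have h2 := expNegInvGlue.nonneg (t₀ - t - d₀ z)
      have h3 := (hw0 z hz).le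
      simp only [coneWeight, energyDensity, Pi.zero_apply]
      positivity
  -- The lower bound for the energy near `y` is independent of `ε`, while the upper bound tends to
  -- `0`.
  have hlim : Tendsto (fun ε : ℝ => C * ε ^ 2) (𝓝[>] 0) (𝓝 0) := by
    have h : Continuous fun ε : ℝ => C * ε ^ 2 := by fun_prop
    have := h.tendsto 0
    simp only [ne_eq, OfNat.ofNat_ne_zero, not_false_eq_true, zero_pow, mul_zero] at this
    exact this.mono_left nhdsWithin_le_nhds
  have hev : ∀ᶠ ε in 𝓝[>] (0 : ℝ), (μH[3] : Measure C2).real (M ∩ V) * c ≤ C * ε ^ 2 := by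
    filter_upwards [Ioo_mem_nhdsGT (show 0 < min δ (dist y x₀ / 8) by positivity)] with ε hε
    exact hlow ε hε.1 hε.2.le
  have := ge_of_tendsto hlim hev
  nlinarith [mul_pos hm hc0]

/-- The cone narrows with time, so the whole segment from `(y, 0)` to `(y, t)` lies in it, and `u y`
is constant along the segment. -/
lemma IsWaveSolution.eq_zero_of_lt (hu : IsWaveSolution M X w T u) {y : C2} (hy : y ∈ M)
    (ht₀T : t₀ ≤ T) (h0 : u y 0 = 0)
    (h1 : ∀ t ∈ Icc 0 t₀, d₀ y < t₀ - t → timeDeriv T u y t = 0) {t : ℝ} (ht : t ∈ Icc 0 t₀)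
    (hyt : d₀ y < t₀ - t) : u y t = 0 := by
  have hC : ContDiffOn ℝ 2 (u y) (Icc 0 T) := ContDiffOn.slice_time hu.1 hy
  have hsub : Icc 0 t ⊆ Icc 0 T := Icc_subset_Icc_right (ht.2.trans ht₀T)
  have := constant_of_has_deriv_right_zero (f := u y) (a := 0) (b := t)
    (hC.continuousOn.mono hsub) (fun s hs => by
      have hsT : s < T := (hs.2.trans_le ht.2).trans_le ht₀T
      have hd : HasDerivWithinAt (u y) (timeDeriv T u y s) (Icc 0 T) s :=
        ((hC s ⟨hs.1, hsT.le⟩).differentiableWithinAt (by simp)).hasDerivWithinAt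
      rw [h1 s ⟨hs.1, hs.2.le.trans ht.2⟩ (by linarith [hs.2])] at hd
      exact hd.mono_of_mem_nhdsWithin (mem_of_superset (Icc_mem_nhdsGE hsT)
        (Icc_subset_Icc_left hs.1)))
  rw [this t ⟨ht.1, le_rfl⟩, h0]

end Propagation

end KohnWave

/-! ### The theorem: passage to the vertex line and to the closed cone -/

/-- Finite speed of propagation, by the energy method. A point has zero capacity for `∂̄_b`, which
deals with the singularity of `d x₀` at `x₀`; pseudoconvexity and finite type are not used. -/
theorem proposition4p2
    (r : KohnWave.C2 → ℝ) (Ω : Set KohnWave.C2) (hΩ : KohnWave.IsPseudoconvexDomain r Ω)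
    (X : Fin 2 → KohnWave.C2 → KohnWave.C2) (hX : KohnWave.IsDbarFrame r Ω X)
    (m : ℕ) (hm : KohnWave.IsOfFiniteType r Ω X m)
    (w : KohnWave.C2 → ℝ) (hw : ContDiffOn ℝ ∞ w (frontier Ω)) (hw0 : ∀ p ∈ frontier Ω, 0 < w p)
    (d : KohnWave.C2 → KohnWave.C2 → ℝ)
    (hd : KohnWave.IsSmoothControlMetric (frontier Ω) X d)
    (T : ℝ) (u : KohnWave.C2 → ℝ → ℂ) (hu : KohnWave.IsWaveSolution (frontier Ω) X w T u)
    (x₀ : KohnWave.C2) (hx₀ : x₀ ∈ frontier Ω) (t₀ : ℝ) (ht₀ : 0 < t₀) (ht₀T : t₀ ≤ T)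
    (hu0 : ∀ y ∈ frontier Ω, d x₀ y ≤ t₀ → u y 0 = 0)
    (hu1 : ∀ y ∈ frontier Ω, d x₀ y ≤ t₀ → KohnWave.timeDeriv T u y 0 = 0) :
    ∀ t ∈ Icc 0 t₀, ∀ y ∈ frontier Ω, d x₀ y ≤ t₀ - t → u y t = 0 := by
  open KohnWave Filter Topology in
  have hr := hΩ.defining.smooth
  have hfr := hΩ.defining.frontier_eq
  have hreg := hΩ.defining.regular
  have hmem : ∀ p ∈ frontier Ω, r p = 0 := fun p hp => by rw [hfr] at hp; exact hp
  have hone : (1 : WithTop ℕ∞) ≤ ∞ := by simp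
  have hM : IsCompactFramed (frontier Ω) X :=
    { compact := isCompact_frontier hΩ.bounded
      measure_lt_top := by
        have hc := isCompact_frontier hΩ.bounded
        rw [hfr] at hc ⊢
        exact hausdorffMeasure_hypersurface_lt_top hr hreg hc
      contDiffOn := fun j => (hX.smooth j).of_le hone
      isVelocity := fun j p hp => by
        obtain ⟨γ, h1, h2, h3, h4⟩ := exists_curve_of_tangent hr (hmem p hp)
          (hreg p (hmem p hp)) (hX.tangent j p hp)
        exact ⟨γ, h1, h2, h3, by rw [hfr]; exact h4⟩ }
  have hpos : ∀ p ∈ frontier Ω, ∀ V ∈ 𝓝[frontier Ω] p, 0 < μH[3] (frontier Ω ∩ V) := by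
    intro p hp V hV
    rw [hfr] at hV ⊢
    exact hausdorffMeasure_hypersurface_pos hr (hmem p hp) (hreg p (hmem p hp)) hV
  have hball := exists_hausdorffMeasure_closedBall_le hr (hmem x₀ hx₀) (hreg x₀ (hmem x₀ hx₀))
  rw [← hfr] at hball
  have hdC : ContDiffOn ℝ 1 (d x₀) (frontier Ω \ {x₀}) :=
    (hd.smooth.of_le hone).comp (contDiffOn_const.prodMk contDiffOn_id)
      fun y hy => ⟨hx₀, hy.1, fun h => hy.2 h.symm⟩
  have hd0 := hd.nonneg x₀ hx₀
  have hoff : ∀ t ∈ Icc 0 t₀, ∀ y ∈ frontier Ω, y ≠ x₀ → d x₀ y < t₀ - t → u y t = 0 := by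
    intro t ht y hy hyx hyt
    refine hu.eq_zero_of_lt (d₀ := d x₀) hy ht₀T (hu0 y hy (by linarith [ht.1])) ?_ ht hyt
    intro s hs hys
    exact hu.timeDeriv_eq_zero hM (hw.of_le hone) hw0 hpos hdC hd0
      (fun y hy hyx => hd.normalized x₀ hx₀ y hy hyx.symm) hball hx₀ ht₀ ht₀T hu0 hu1 hs hy hyx hys
  -- the points of the vertical line over `x₀` are limits of points off it
  have hon : ∀ t ∈ Icc 0 t₀, t < t₀ → u x₀ t = 0 := by
    intro t ht htt
    -- Points approaching `x₀` in `M` must be found inside the cone, that is, with `d x₀` small. An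
    -- admissible path of duration `τ` bounds the control distance by `τ`, and comparability then
    -- gives `d x₀ (γ τ) ≤ C τ`.
    obtain ⟨γ, hγ, hadm⟩ := exists_admissiblePath hr hreg (hfr ▸ hX.smooth 0)
      (fun z hz => hX.tangent 0 z (by rw [hfr]; exact hz)) (hmem x₀ hx₀) (hX.ne_zero x₀ hx₀)
    rw [← hfr] at hadm
    obtain ⟨C, hC⟩ := hd.comparable
    have hsmall : ∀ᶠ τ in 𝓝[>] (0 : ℝ), (C : ℝ) * τ < t₀ - t := by
      have h : Continuous fun τ : ℝ => (C : ℝ) * τ := by fun_prop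
      have h' := h.tendsto 0
      rw [mul_zero] at h'
      exact (h'.mono_left nhdsWithin_le_nhds).eventually_lt_const (by linarith)
    have hzero : ∀ᶠ τ in 𝓝[>] (0 : ℝ), γ τ ∈ frontier Ω ∧ u (γ τ) t = 0 := by
      filter_upwards [hadm, hsmall, self_mem_nhdsWithin, hγ.eventually self_mem_nhdsWithin]
        with τ h1 h2 h3 h4
      have hτ : (0 : ℝ) < τ := h3
      have hγM : γ τ ∈ frontier Ω := h1.2.1 τ ⟨hτ.le, le_rfl⟩
      refine ⟨hγM, hoff t ht _ hγM h4 ?_⟩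
      have h5 : controlDist (frontier Ω) X x₀ (γ τ) ≤ ENNReal.ofReal τ :=
        iInf_le_of_le τ (iInf_le_of_le hτ (iInf_le_of_le ⟨γ, h1⟩ le_rfl))
      have h6 : ENNReal.ofReal (d x₀ (γ τ)) ≤ ENNReal.ofReal (C * τ) := by
        rw [ENNReal.ofReal_mul C.coe_nonneg, ENNReal.ofReal_coe_nnreal]
        exact ((hC x₀ hx₀ _ hγM).1).trans (mul_le_mul_right h5 _)
      have h7 := (ENNReal.ofReal_le_ofReal_iff (by positivity)).mp h6
      linarith
    have hcont : ContinuousWithinAt (fun y => u y t) (frontier Ω) x₀ :=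
      (ContDiffOn.slice_space hu.1 ⟨ht.1, ht.2.trans ht₀T⟩).continuousOn x₀ hx₀
    have hγ' : Tendsto γ (𝓝[>] 0) (𝓝[frontier Ω] x₀) :=
      tendsto_nhdsWithin_iff.mpr ⟨hγ.mono_right nhdsWithin_le_nhds, hzero.mono fun _ h => h.1⟩
    exact tendsto_nhds_unique (hcont.tendsto.comp hγ')
      (tendsto_const_nhds.congr' (hzero.mono fun _ h => h.2.symm))
  have hopen : ∀ t ∈ Icc 0 t₀, ∀ y ∈ frontier Ω, d x₀ y < t₀ - t → u y t = 0 := by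
    intro t ht y hy hyt
    by_cases hyx : y = x₀
    · subst hyx
      exact hon t ht (by linarith [hd0 y hy])
    · exact hoff t ht y hy hyx hyt
  intro t ht y hy hyt
  -- On the boundary of the cone, `t = 0` is the initial condition. For `t > 0`, every earlier time
  -- at the same `y` lies strictly inside the cone, and continuity in time concludes.
  rcases ht.1.eq_or_lt with h | h
  · subst h
    exact hu0 y hy (by linarith)
  · have hC : ContinuousOn (u y) (Icc 0 t) :=
      (ContDiffOn.slice_time hu.1 hy).continuousOn.mono
        (Icc_subset_Icc_right (ht.2.trans ht₀T))
    have heq : EqOn (u y) (fun _ => 0) (Ico 0 t) := fun s hs =>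
      hopen s ⟨hs.1, hs.2.le.trans ht.2⟩ y hy (by linarith [hs.2])
    exact heq.of_subset_closure hC continuousOn_const Ico_subset_Icc_self
      (by rw [closure_Ico h.ne]) ⟨h.le, le_rfl⟩
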